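/- Let $\mathcal O$ be a Dedekind domain, $\pi\in\mathcal O$ a generator of a nonzero prime ideal $\mathfrak p$ with finite residue field, $q=\#(\mathcal O/\mathfrak p)$, and $C_\pi(X,Y)=\frac{X^q+Y^q-(X+Y)^q}{\pi}\in\mathcal O[X,Y]$ (which is $0$ in positive characteristic). Given a ring homomorphism $u:B\to C$ of $\mathcal O$-algebras, a $\pi$-derivation with respect to $u$ is a map $d:B\to C$ with $$d(x+y)=d(x)+d(y)+C_\pi(u(x),u(y)),\qquad d(xy)=u(x)^qd(y)+u(y)^qd(x)+\pi\, d(x)d(y).$$ Let $R$ be an $\mathcal O$-algebra with a $\pi$-derivation $\delta:R\to R$ (with respect to the identity) compatible with $\mathcal O$, i.e. $\delta(c\cdot 1)=\frac{c-c^q}{\pi}\cdot 1$ for $c\in\mathcal O$. For $R$-algebras $B,C$ and an $R$-algebra map $u: B\to C$, a pair $(u,d)$ is a prolongation if $d$ is a $\pi$-derivation with respect to $u$ extending $\delta$; its Frobenius lift is $x\mapsto u(x)^q+\pi d(x)$. For $A=R[x]/I$, with $x$ any family of indeterminates and $I$ any ideal, extend $\delta$ to the polynomial rings by $\delta x^{(j)}=x^{(j+1)}$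 and put $$J_nA=R[x,x',\dots,x^{(n)}]/(I,\delta I,\dots,\delta^nI),\qquad J^n(\operatorname{Spec}A)=\operatorname{Spec}J_nA .$$ With the canonical maps $u:J_kA\to J_lA$ $(k\le l)$ and the induced $\delta:J_nA\to J_{n+1}A$ these form the canonical prolongation sequence of $\operatorname{Spec} A$; let $\phi:J_nA\to J_{n+1}A$ be its Frobenius lift. Let $P:A\to R$ be an $R$-algebra map (a marked $R$-point of $X=\operatorname{Spec}A$), and for $m\ge 0$ let $P_m:J_mA\to R$, $x^{(j)}\mapsto\delta^j(P(x))$, be the induced point of $J^mX$. Put $$N_{[m]n}A=J_{m+n}A\otimes_{J_mA,P_m}R,\qquad N^{[m]n}X=J^{m+n}X\times_{J^mX,P_m}\operatorname{Spec}R=\operatorname{Spec}N_{[m]n}A,$$ with the canonical maps $i:J_{m+n}A\to N_{[m]n}A$ and $u:N_{[m]n}A\to N_{[m]n+1}A$. **Theorem.** For all $m\ge0$ and all $n\ge1$ there are isomorphisms of $R$-algebras $$\theta_n: J_{n-1}(N_{[m]1}A)\xrightarrow{\ \sim\ }N_{[m]n}A,\qquad\text{i.e. isomorphisms of $R$-schemes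 } N^{[m]n}X\simeq J^{n-1}(N^{[m]1}X),$$ where $J_{n-1}(N_{[m]1}A)$ may be computed from any presentation of the $R$-algebra $N_{[m]1}A$. Moreover $\{N^{[m]n}X\}_{n\ge1}$ is the canonical prolongation sequence attached to $N^{[m]1}X$: there are $\pi$-derivations $\Delta:N_{[m]n}A\to N_{[m]n+1}A$ $(n\ge1)$ with respect to $u$, extending $\delta$ and satisfying $\Delta u=u\Delta$, such that the $\theta_n$ can be chosen compatible with the maps $u$ and to carry $\delta$ on $J_*(N_{[m]1}A)$ to $\Delta$, with $\theta_1$ the canonical isomorphism $J_0(N_{[m]1}A)=N_{[m]1}A$; and the Frobenius lift $\mathfrak f(y)=u(y)^q+\pi\Delta(y)$ is lateral: $$\mathfrak f\circ i\circ\phi^{m+1}=i\circ\phi^{m+2}:\ J_{n-1}A\to N_{[m]n+1}A\qquad(n\ge1).$$ -/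

import Mathlib

namespace PiJet

set_option linter.unusedSectionVars false

open MvPolynomial

section Base

variable {O : Type*} [CommRing O]

/-- The cardinality `q` of the residue field `O / (π)`. -/
noncomputable def resCard (π : O) : ℕ := Nat.card (O ⧸ Ideal.span {π})

open Classical in
/-- Exact division by `π`: the quotient `a / π` when `π ∣ a` (and `0` otherwise). -/
noncomputable def divPi (π a : O) : O := if h : π ∣ a then h.choose else 0

theorem mul_divPi {π a : O} (h : π ∣ a) : π * divPi π a = a := by
  rw [divPi, dif_pos h]
  exact h.choose_spec.symm

/-- The value at `(x, y)` of `C_π(X, Y) = (X ^ q + Y ^ q - (X + Y) ^ q) / π`, in an `R`-algebra `B`.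
The coefficients `- (q choose i) / π` are computed in `O`; they vanish if `O` has positive
characteristic. -/
noncomputable def cSum (π : O) (R : Type*) [CommRing R] [Algebra O R] {B : Type*} [CommRing B]
    [Algebra R B] (x y : B) : B :=
  -∑ i ∈ Finset.Ioo 0 (resCard π),
    algebraMap R B (algebraMap O R (divPi π ((resCard π).choose i : O))) *
      (x ^ i * y ^ (resCard π - i))

/-- The image of `π` in an `R`-algebra `B`. -/
def piIn (π : O) (R : Type*) [CommRing R] [Algebra O R] (B : Type*) [CommRing B] [Algebra R B] :
    B :=
  algebraMap R B (algebraMap O R π)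

variable [IsDomain O] (π : O) [Fact (Prime π)] [Finite (O ⧸ Ideal.span {π})]

theorem exists_prime_pow : ∃ p n : ℕ, p.Prime ∧ n ≠ 0 ∧ resCard π = p ^ n ∧ π ∣ (p : O) := by
  have hp : Prime π := Fact.out
  have : (Ideal.span {π}).IsPrime := (Ideal.span_singleton_prime hp.ne_zero).2 hp
  let _ : Fintype (O ⧸ Ideal.span {π}) := Fintype.ofFinite _
  let _ : Field (O ⧸ Ideal.span {π}) := (Finite.isField_of_domain _).toField
  obtain ⟨p, hc⟩ := CharP.exists (O ⧸ Ideal.span {π})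
  obtain ⟨n, h1, h2⟩ := FiniteField.card (O ⧸ Ideal.span {π}) p
  refine ⟨p, n, h1, n.ne_zero, ?_, ?_⟩
  · rw [resCard, Nat.card_eq_fintype_card, h2]
  · rw [← Ideal.mem_span_singleton, ← Ideal.Quotient.eq_zero_iff_mem, map_natCast]
    exact CharP.cast_eq_zero _ p

theorem resCard_pos : 0 < resCard π := by
  obtain ⟨p, n, h1, -, h2, -⟩ := exists_prime_pow π
  rw [h2]
  exact pow_pos h1.pos n

theorem dvd_choose {i : ℕ} (h0 : 0 < i) (h1 : i < resCard π) :
    π ∣ ((resCard π).choose i : O) := by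
  obtain ⟨p, n, hp, -, h2, h3⟩ := exists_prime_pow π
  refine h3.trans ?_
  rw [h2] at h1 ⊢
  exact_mod_cast (Nat.cast_dvd_cast (hp.dvd_choose_pow h0.ne' h1.ne))

/-- Every element of the residue field satisfies `c ^ q = c`. -/
theorem dvd_sub_pow (c : O) : π ∣ c - c ^ resCard π := by
  have hp : Prime π := Fact.out
  have : (Ideal.span {π}).IsPrime := (Ideal.span_singleton_prime hp.ne_zero).2 hp
  let _ : Fintype (O ⧸ Ideal.span {π}) := Fintype.ofFinite _
  let _ : Field (O ⧸ Ideal.span {π}) := (Finite.isField_of_domain _).toField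
  rw [← Ideal.mem_span_singleton, ← Ideal.Quotient.eq_zero_iff_mem, map_sub, map_pow, resCard,
    Nat.card_eq_fintype_card, FiniteField.pow_card, sub_self]

variable (R : Type*) [CommRing R] [Algebra O R] {B : Type*} [CommRing B] [Algebra R B]

theorem pi_mul_cSum (x y : B) : piIn π R B * cSum π R x y =
    x ^ resCard π + y ^ resCard π - (x + y) ^ resCard π := by
  have hq := resCard_pos π
  have h : piIn π R B * cSum π R x y = -∑ i ∈ Finset.Ioo 0 (resCard π),
      x ^ i * y ^ (resCard π - i) * ((resCard π).choose i : B) := by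
    rw [cSum, mul_neg, Finset.mul_sum]
    congr 1
    refine Finset.sum_congr rfl fun i hi => ?_
    rw [Finset.mem_Ioo] at hi
    rw [piIn, ← mul_assoc, ← map_mul, ← map_mul, mul_divPi (dvd_choose π hi.1 hi.2), map_natCast,
      map_natCast, mul_comm]
  have h2 : Finset.range (resCard π) = insert 0 (Finset.Ioo 0 (resCard π)) := by
    ext i
    simp only [Finset.mem_range, Finset.mem_insert, Finset.mem_Ioo]
    omega
  rw [h, add_pow, Finset.sum_range_succ, h2, Finset.sum_insert (by simp)]
  simp
  ring

theorem cSum_map (S : Type*) [CommRing S] [Algebra O S] {D : Type*} [CommRing D] [Algebra S D]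
    (g : B →+* D)
    (hg : ∀ c : O, g (algebraMap R B (algebraMap O R c)) = algebraMap S D (algebraMap O S c))
    (x y : B) : g (cSum π R x y) = cSum π S (g x) (g y) := by
  simp [cSum, hg]

theorem cSum_map_algHom {D : Type*} [CommRing D] [Algebra R D] (g : B →ₐ[R] D) (x y : B) :
    g (cSum π R x y) = cSum π R (g x) (g y) :=
  cSum_map π R R g.toRingHom (fun _ => g.commutes _) x y

theorem cSum_comm (x y : B) : cSum π R x y = cSum π R y x := by
  have hp : Prime π := Fact.out
  let F := MvPolynomial (Fin 2) O
  have key : cSum π O (X 0 : F) (X 1) = cSum π O (X 1 : F) (X 0) := by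
    have h0 : piIn π O F ≠ 0 := by
      rw [piIn]; simpa [F, algebraMap_eq] using hp.ne_zero
    apply mul_left_cancel₀ h0
    rw [pi_mul_cSum, pi_mul_cSum]; ring
  have := congrArg
    (eval₂Hom ((algebraMap R B).comp (algebraMap O R)) (![x, y] : Fin 2 → B)) key
  rw [cSum_map π O R _ (by intro c; simp [algebraMap_eq]),
    cSum_map π O R _ (by intro c; simp [algebraMap_eq])] at this
  simpa using this

theorem cSum_zero (x : B) : cSum π R x 0 = 0 := by
  rw [cSum, Finset.sum_eq_zero, neg_zero]
  intro i hi
  rw [Finset.mem_Ioo] at hi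
  rw [zero_pow (by omega), mul_zero, mul_zero]

theorem cSum_assoc (x y z : B) :
    cSum π R x y + cSum π R (x + y) z = cSum π R y z + cSum π R x (y + z) := by
  have hp : Prime π := Fact.out
  let F := MvPolynomial (Fin 3) O
  have key : cSum π O (X 0 : F) (X 1) + cSum π O (X 0 + X 1 : F) (X 2) =
      cSum π O (X 1 : F) (X 2) + cSum π O (X 0 : F) (X 1 + X 2) := by
    have h0 : piIn π O F ≠ 0 := by
      rw [piIn]; simpa [F, algebraMap_eq] using hp.ne_zero
    apply mul_left_cancel₀ h0
    rw [mul_add, mul_add, pi_mul_cSum, pi_mul_cSum, pi_mul_cSum, pi_mul_cSum, add_assoc (X 0)]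
    ring
  have := congrArg
    (eval₂Hom ((algebraMap R B).comp (algebraMap O R)) (![x, y, z] : Fin 3 → B)) key
  rw [map_add, map_add, cSum_map π O R _ (by intro c; simp [algebraMap_eq]),
    cSum_map π O R _ (by intro c; simp [algebraMap_eq]),
    cSum_map π O R _ (by intro c; simp [algebraMap_eq]),
    cSum_map π O R _ (by intro c; simp [algebraMap_eq])] at this
  simpa [F, eval₂_add] using this

theorem cSum_mul (x y z : B) : x ^ resCard π * cSum π R y z = cSum π R (x * y) (x * z) := by
  rw [cSum, cSum, mul_neg, Finset.mul_sum]
  congr 1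
  refine Finset.sum_congr rfl fun i hi => ?_
  rw [Finset.mem_Ioo] at hi
  have : x ^ resCard π = x ^ i * x ^ (resCard π - i) := by rw [← pow_add]; congr 1; omega
  rw [this, mul_pow, mul_pow]
  ring

end Base

section Derivation

/-- A `π`-derivation `δ` on the `O`-algebra `R`, compatible with the one of `O` (for which the
Frobenius lift `c ^ q + π δ c` is the identity). -/
structure PiDerivation {O : Type*} [CommRing O] (π : O) (R : Type*) [CommRing R]
    [Algebra O R] where
  /-- The underlying map of sets. -/
  toFun : R → R
  map_base (c : O) :
    toFun (algebraMap O R c) = algebraMap O R (divPi π (c - c ^ resCard π))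
  map_add (x y : R) : toFun (x + y) = toFun x + toFun y + cSum π R x y
  map_mul (x y : R) : toFun (x * y) =
    x ^ resCard π * toFun y + y ^ resCard π * toFun x + algebraMap O R π * (toFun x * toFun y)

variable {O : Type*} [CommRing O] {π : O} {R : Type*} [CommRing R] [Algebra O R]

/-- A prolongation `(u, d)` of `R`-algebras: a `π`-derivation `d : B → C` with respect to
`u : B → C` that extends the `π`-derivation `δ` of `R`. -/
structure Prolongation (δ : PiDerivation π R) {B C : Type*} [CommRing B] [Algebra R B]
    [CommRing C] [Algebra R C] (u : B →ₐ[R] C) where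
  /-- The underlying map of sets. -/
  toFun : B → C
  map_base (r : R) : toFun (algebraMap R B r) = algebraMap R C (δ.toFun r)
  map_add (x y : B) : toFun (x + y) = toFun x + toFun y + cSum π R (u x) (u y)
  map_mul (x y : B) : toFun (x * y) = u x ^ resCard π * toFun y + u y ^ resCard π * toFun x +
    piIn π R C * (toFun x * toFun y)

/-- The Frobenius lift `x ↦ u(x) ^ q + π d(x)` attached to maps `u, d : B → C`. -/
noncomputable def frob (π : O) (R : Type*) [CommRing R] [Algebra O R] {B C : Type*} [CommRing C]
    [Algebra R C] (u d : B → C) (x : B) : C :=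
  u x ^ resCard π + piIn π R C * d x

end Derivation

section WittOne

/-- The ring `W₁(B)` of `π`-typical Witt vectors of length two. Ring homomorphisms
`x ↦ (u x, d x)` into it are the same as `π`-derivations `d` with respect to `u`. -/
@[ext]
structure W1 {O : Type*} (π : O) (R : Type*) (B : Type*) where
  /-- The component of index zero. -/
  fst : B
  /-- The component of index one. -/
  snd : B

variable {O : Type*} [CommRing O] [IsDomain O] {π : O} [Fact (Prime π)]
  [Finite (O ⧸ Ideal.span {π})]
  {R : Type*} [CommRing R] [Algebra O R] {B : Type*} [CommRing B] [Algebra R B]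

noncomputable instance : Zero (W1 π R B) := ⟨⟨0, 0⟩⟩

noncomputable instance : One (W1 π R B) := ⟨⟨1, 0⟩⟩

noncomputable instance : Add (W1 π R B) :=
  ⟨fun a b => ⟨a.fst + b.fst, a.snd + b.snd + cSum π R a.fst b.fst⟩⟩

noncomputable instance : Mul (W1 π R B) :=
  ⟨fun a b => ⟨a.fst * b.fst, a.fst ^ resCard π * b.snd + b.fst ^ resCard π * a.snd +
    piIn π R B * (a.snd * b.snd)⟩⟩

noncomputable instance : Neg (W1 π R B) :=
  ⟨fun a => ⟨-a.fst, -a.snd - cSum π R a.fst (-a.fst)⟩⟩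

noncomputable instance W1.instCommRing : CommRing (W1 π R B) where
  nsmul := nsmulRec
  zsmul := zsmulRec
  npow := npowRec
  add_assoc a b c := W1.ext (add_assoc _ _ _) (by
    change a.snd + b.snd + cSum π R a.fst b.fst + c.snd + cSum π R (a.fst + b.fst) c.fst =
      a.snd + (b.snd + c.snd + cSum π R b.fst c.fst) + cSum π R a.fst (b.fst + c.fst)
    linear_combination cSum_assoc π R a.fst b.fst c.fst)
  add_comm a b := W1.ext (add_comm _ _) (by
    change a.snd + b.snd + cSum π R a.fst b.fst = b.snd + a.snd + cSum π R b.fst a.fst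
    rw [cSum_comm]; ring)
  zero_add a := W1.ext (zero_add _) (by
    change 0 + a.snd + cSum π R 0 a.fst = a.snd
    rw [cSum_comm, cSum_zero]; ring)
  add_zero a := W1.ext (add_zero _) (by
    change a.snd + 0 + cSum π R a.fst 0 = a.snd
    rw [cSum_zero]; ring)
  neg_add_cancel a := W1.ext (neg_add_cancel _) (by
    change -a.snd - cSum π R a.fst (-a.fst) + a.snd + cSum π R (-a.fst) a.fst = 0
    rw [cSum_comm π R (-a.fst)]; ring)
  mul_assoc a b c := W1.ext (mul_assoc _ _ _) (by
    change (a.fst * b.fst) ^ resCard π * c.snd + c.fst ^ resCard π *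
        (a.fst ^ resCard π * b.snd + b.fst ^ resCard π * a.snd + piIn π R B * (a.snd * b.snd)) +
        piIn π R B * ((a.fst ^ resCard π * b.snd + b.fst ^ resCard π * a.snd +
          piIn π R B * (a.snd * b.snd)) * c.snd) =
      a.fst ^ resCard π * (b.fst ^ resCard π * c.snd + c.fst ^ resCard π * b.snd +
          piIn π R B * (b.snd * c.snd)) + (b.fst * c.fst) ^ resCard π * a.snd +
        piIn π R B * (a.snd * (b.fst ^ resCard π * c.snd + c.fst ^ resCard π * b.snd +
          piIn π R B * (b.snd * c.snd)))
    rw [mul_pow, mul_pow]; ring)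
  mul_comm a b := W1.ext (mul_comm _ _) (by
    change a.fst ^ resCard π * b.snd + b.fst ^ resCard π * a.snd + piIn π R B * (a.snd * b.snd) =
      b.fst ^ resCard π * a.snd + a.fst ^ resCard π * b.snd + piIn π R B * (b.snd * a.snd)
    ring)
  one_mul a := W1.ext (one_mul _) (by
    change 1 ^ resCard π * a.snd + a.fst ^ resCard π * 0 + piIn π R B * (0 * a.snd) = a.snd
    rw [one_pow]; ring)
  mul_one a := W1.ext (mul_one _) (by
    change a.fst ^ resCard π * 0 + 1 ^ resCard π * a.snd + piIn π R B * (a.snd * 0) = a.snd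
    rw [one_pow]; ring)
  zero_mul a := W1.ext (zero_mul _) (by
    change 0 ^ resCard π * a.snd + a.fst ^ resCard π * 0 + piIn π R B * (0 * a.snd) = 0
    rw [zero_pow (resCard_pos π).ne']; ring)
  mul_zero a := W1.ext (mul_zero _) (by
    change a.fst ^ resCard π * 0 + 0 ^ resCard π * a.snd + piIn π R B * (a.snd * 0) = 0
    rw [zero_pow (resCard_pos π).ne']; ring)
  left_distrib a b c := W1.ext (mul_add _ _ _) (by
    change a.fst ^ resCard π * (b.snd + c.snd + cSum π R b.fst c.fst) +
        (b.fst + c.fst) ^ resCard π * a.snd +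
        piIn π R B * (a.snd * (b.snd + c.snd + cSum π R b.fst c.fst)) =
      a.fst ^ resCard π * b.snd + b.fst ^ resCard π * a.snd + piIn π R B * (a.snd * b.snd) +
        (a.fst ^ resCard π * c.snd + c.fst ^ resCard π * a.snd + piIn π R B * (a.snd * c.snd)) +
        cSum π R (a.fst * b.fst) (a.fst * c.fst)
    linear_combination cSum_mul π R a.fst b.fst c.fst + a.snd * pi_mul_cSum π R b.fst c.fst)
  right_distrib a b c := W1.ext (add_mul _ _ _) (by
    change (a.fst + b.fst) ^ resCard π * c.snd +
        c.fst ^ resCard π * (a.snd + b.snd + cSum π R a.fst b.fst) +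
        piIn π R B * ((a.snd + b.snd + cSum π R a.fst b.fst) * c.snd) =
      a.fst ^ resCard π * c.snd + c.fst ^ resCard π * a.snd + piIn π R B * (a.snd * c.snd) +
        (b.fst ^ resCard π * c.snd + c.fst ^ resCard π * b.snd + piIn π R B * (b.snd * c.snd)) +
        cSum π R (a.fst * c.fst) (b.fst * c.fst)
    rw [mul_comm a.fst c.fst, mul_comm b.fst c.fst]
    linear_combination cSum_mul π R c.fst a.fst b.fst + c.snd * pi_mul_cSum π R a.fst b.fst)

theorem W1.fst_add (a b : W1 π R B) : (a + b).fst = a.fst + b.fst := rfl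
theorem W1.snd_add (a b : W1 π R B) :
    (a + b).snd = a.snd + b.snd + cSum π R a.fst b.fst := rfl
theorem W1.fst_mul (a b : W1 π R B) : (a * b).fst = a.fst * b.fst := rfl
theorem W1.snd_mul (a b : W1 π R B) : (a * b).snd = a.fst ^ resCard π * b.snd +
    b.fst ^ resCard π * a.snd + piIn π R B * (a.snd * b.snd) := rfl
theorem W1.fst_zero : (0 : W1 π R B).fst = 0 := rfl
theorem W1.snd_zero : (0 : W1 π R B).snd = 0 := rfl
theorem W1.fst_one : (1 : W1 π R B).fst = 1 := rfl
theorem W1.snd_one : (1 : W1 π R B).snd = 0 := rfl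

/-- The projection `W₁(B) → B`. -/
def W1.fstHom : W1 π R B →+* B where
  toFun := W1.fst
  map_one' := rfl
  map_mul' _ _ := rfl
  map_zero' := rfl
  map_add' _ _ := rfl

/-- Functoriality of `W₁`. -/
def W1.map {D : Type*} [CommRing D] [Algebra R D] (g : B →ₐ[R] D) : W1 π R B →+* W1 π R D where
  toFun a := ⟨g a.fst, g a.snd⟩
  map_one' := W1.ext (map_one g) (map_zero g)
  map_zero' := W1.ext (map_zero g) (map_zero g)
  map_mul' a b := W1.ext (map_mul g _ _) (by
    simp only [W1.snd_mul, _root_.map_add, _root_.map_mul, map_pow]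
    rw [piIn, piIn, g.commutes])
  map_add' a b := W1.ext (_root_.map_add g _ _) (by
    simp only [W1.snd_add, _root_.map_add, cSum_map_algHom])

theorem PiDerivation.map_zero (δ : PiDerivation π R) : δ.toFun 0 = 0 := by
  have h := δ.map_add 0 0
  rw [add_zero, cSum_zero] at h
  linear_combination -h

theorem PiDerivation.map_one (δ : PiDerivation π R) : δ.toFun 1 = 0 := by
  have hp : Prime π := Fact.out
  have h := δ.map_base 1
  have h2 : π * divPi π ((1 : O) - 1 ^ resCard π) = 0 := by
    rw [mul_divPi (dvd_sub_pow π 1)]; simp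
  rw [(mul_eq_zero.1 h2).resolve_left hp.ne_zero] at h
  simpa using h

/-- The ring homomorphism `R → W₁(B)`, `r ↦ (r, δ r)`. -/
def PiDerivation.hom (δ : PiDerivation π R) (B : Type*) [CommRing B] [Algebra R B] :
    R →+* W1 π R B where
  toFun r := ⟨algebraMap R B r, algebraMap R B (δ.toFun r)⟩
  map_one' := W1.ext (_root_.map_one _) (by rw [δ.map_one, _root_.map_zero]; rfl)
  map_zero' := W1.ext (_root_.map_zero _) (by rw [δ.map_zero, _root_.map_zero]; rfl)
  map_mul' x y := W1.ext (_root_.map_mul _ _ _) (by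
    rw [δ.map_mul, W1.snd_mul, piIn]
    simp only [_root_.map_add, _root_.map_mul, map_pow])
  map_add' x y := W1.ext (_root_.map_add _ _ _) (by
    have h : algebraMap R B (cSum π R x y) = cSum π R (algebraMap R B x) (algebraMap R B y) :=
      cSum_map_algHom π R (Algebra.ofId R B) x y
    rw [δ.map_add, W1.snd_add, _root_.map_add, _root_.map_add, _root_.map_add, h])

end WittOne

section Jet

variable {O : Type*} [CommRing O] [IsDomain O] {π : O} [Fact (Prime π)]
  [Finite (O ⧸ Ideal.span {π})]
  {R : Type*} [CommRing R] [Algebra O R]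

/-- The polynomial ring `R[x, x', …, x⁽ⁿ⁾]`, where `x = (x_s)_{s ∈ σ}` is a family of
indeterminates; the variable `X (s, j)` is `x_s⁽ʲ⁾`. -/
abbrev JetPoly (R : Type*) [CommRing R] (σ : Type*) (n : ℕ) : Type _ :=
  MvPolynomial (σ × Fin (n + 1)) R

/-- The inclusion `R[x, …, x⁽ᵏ⁾] → R[x, …, x⁽ˡ⁾]` for `k ≤ l`. -/
noncomputable def polyIncl (R : Type*) [CommRing R] (σ : Type*) {k l : ℕ} (h : k ≤ l) :
    JetPoly R σ k →ₐ[R] JetPoly R σ l :=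
  rename (Prod.map id (Fin.castLE (Nat.succ_le_succ h)))

/-- The ring homomorphism `f ↦ (f, δ f)` that characterizes `polyDelta`. -/
noncomputable def polyHom (δ : PiDerivation π R) (σ : Type*) (n : ℕ) :
    JetPoly R σ n →+* W1 π R (JetPoly R σ (n + 1)) :=
  eval₂Hom (δ.hom (JetPoly R σ (n + 1))) fun v => ⟨X (v.1, v.2.castSucc), X (v.1, v.2.succ)⟩

/-- The `π`-derivation `R[x, …, x⁽ⁿ⁾] → R[x, …, x⁽ⁿ⁺¹⁾]` that extends `δ` and takes `x⁽ʲ⁾` to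
`x⁽ʲ⁺¹⁾`. -/
noncomputable def polyDelta (δ : PiDerivation π R) (σ : Type*) (n : ℕ) (f : JetPoly R σ n) :
    JetPoly R σ (n + 1) :=
  (polyHom δ σ n f).snd

theorem polyHom_fst (δ : PiDerivation π R) (σ : Type*) (n : ℕ) (f : JetPoly R σ n) :
    (polyHom δ σ n f).fst = polyIncl R σ n.le_succ f := by
  have : W1.fstHom.comp (polyHom δ σ n) = (polyIncl R σ n.le_succ).toRingHom := by
    apply MvPolynomial.ringHom_ext
    · intro r
      simp [polyHom, PiDerivation.hom, W1.fstHom, algebraMap_eq, polyIncl]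
    · intro v
      simp [polyHom, W1.fstHom, polyIncl]
      rfl
  exact congrArg (fun g => g f) this

/-- `polyDelta` is a prolongation of the inclusion. -/
noncomputable def polyProlongation (δ : PiDerivation π R) (σ : Type*) (n : ℕ) :
    Prolongation δ (polyIncl R σ n.le_succ) where
  toFun := polyDelta δ σ n
  map_base r := by simp [polyDelta, polyHom, PiDerivation.hom, algebraMap_eq]
  map_add x y := by
    rw [polyDelta, _root_.map_add, W1.snd_add, polyHom_fst, polyHom_fst]; rfl
  map_mul x y := by
    rw [polyDelta, _root_.map_mul, W1.snd_mul, polyHom_fst, polyHom_fst]; rfl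

theorem polyDelta_X (δ : PiDerivation π R) (σ : Type*) (n : ℕ) (s : σ) (j : Fin (n + 1)) :
    polyDelta δ σ n (X (s, j)) = X (s, j.succ) := by
  simp [polyDelta, polyHom]

theorem polyDelta_incl (δ : PiDerivation π R) (σ : Type*) {k l : ℕ} (h : k ≤ l)
    (f : JetPoly R σ k) : polyDelta δ σ l (polyIncl R σ h f) =
      polyIncl R σ (Nat.succ_le_succ h) (polyDelta δ σ k f) := by
  have : (polyHom δ σ l).comp (polyIncl R σ h).toRingHom =
      (W1.map (polyIncl R σ (Nat.succ_le_succ h))).comp (polyHom δ σ k) := by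
    apply MvPolynomial.ringHom_ext
    · intro r
      simp [polyHom, PiDerivation.hom, algebraMap_eq, polyIncl, W1.map]
    · intro v
      apply W1.ext
      · simp [polyHom, polyIncl, W1.map]
      · simp [polyHom, polyIncl, W1.map]
  exact congrArg W1.snd (congrArg (fun g => g f) this)

/-- The iterate `δ^i f ∈ R[x, …, x⁽ⁱ⁾]` of a polynomial `f ∈ R[x]`. -/
noncomputable def polyIter (δ : PiDerivation π R) (σ : Type*) (f : MvPolynomial σ R) :
    (i : ℕ) → JetPoly R σ i
  | 0 => rename (fun s => (s, 0)) f
  | i + 1 => polyDelta δ σ i (polyIter δ σ f i)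

variable {σ : Type*}

/-- The ideal `(I, δ I, …, δⁿ I)` of `R[x, …, x⁽ⁿ⁾]`. -/
noncomputable def jetIdeal (δ : PiDerivation π R) (I : Ideal (MvPolynomial σ R)) (n : ℕ) :
    Ideal (JetPoly R σ n) :=
  Ideal.span {g | ∃ (i : ℕ) (h : i ≤ n), ∃ f ∈ I, g = polyIncl R σ h (polyIter δ σ f i)}

/-- The jet algebra `J_n A = R[x, x', …, x⁽ⁿ⁾] / (I, δ I, …, δⁿ I)` of `A = R[x] / I`. -/
abbrev JetAlg (δ : PiDerivation π R) (I : Ideal (MvPolynomial σ R)) (n : ℕ) : Type _ :=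
  JetPoly R σ n ⧸ jetIdeal δ I n

variable (δ : PiDerivation π R) (I : Ideal (MvPolynomial σ R))

/-- The canonical map `A → J_0 A` (an isomorphism), for `A = R[x] / I`. -/
noncomputable def jetBase : (MvPolynomial σ R ⧸ I) →ₐ[R] JetAlg δ I 0 :=
  Ideal.quotientMapₐ (jetIdeal δ I 0) (rename fun s => (s, 0)) (by
    intro f hf
    refine Ideal.subset_span ⟨0, le_rfl, f, hf, ?_⟩
    simp [polyIncl, polyIter])

theorem polyIncl_trans {j k l : ℕ} (h : j ≤ k) (h' : k ≤ l) (f : JetPoly R σ j) :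
    polyIncl R σ h' (polyIncl R σ h f) = polyIncl R σ (h.trans h') f := by
  rw [polyIncl, polyIncl, rename_rename]
  rfl

/-- The canonical map `u : J_k A → J_l A` for `k ≤ l`. -/
noncomputable def jetIncl {k l : ℕ} (h : k ≤ l) : JetAlg δ I k →ₐ[R] JetAlg δ I l :=
  Ideal.quotientMapₐ (jetIdeal δ I l) (polyIncl R σ h) (by
    rw [jetIdeal, Ideal.span_le]
    rintro _ ⟨i, hi, f, hf, rfl⟩
    exact Ideal.subset_span ⟨i, hi.trans h, f, hf, polyIncl_trans hi h _⟩)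

/-- The ring homomorphism `y ↦ (u y, δ y)` that characterizes `jetDelta`. -/
noncomputable def jetHom (n : ℕ) : JetAlg δ I n →+* W1 π R (JetAlg δ I (n + 1)) :=
  Ideal.Quotient.lift (jetIdeal δ I n)
    ((W1.map (Ideal.Quotient.mkₐ R (jetIdeal δ I (n + 1)))).comp (polyHom δ σ n)) (by
    intro g hg
    change g ∈ RingHom.ker _
    revert g
    change jetIdeal δ I n ≤ _
    conv_lhs => rw [jetIdeal]
    rw [Ideal.span_le]
    rintro _ ⟨i, hi, f, hf, rfl⟩
    refine W1.ext ?_ ?_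
    · change Ideal.Quotient.mk _ (polyHom δ σ n _).fst = 0
      rw [polyHom_fst, Ideal.Quotient.eq_zero_iff_mem]
      exact Ideal.subset_span ⟨i, hi.trans n.le_succ, f, hf, polyIncl_trans _ _ _⟩
    · change Ideal.Quotient.mk _ (polyDelta δ σ n _) = 0
      rw [polyDelta_incl, Ideal.Quotient.eq_zero_iff_mem]
      exact Ideal.subset_span ⟨i + 1, Nat.succ_le_succ hi, f, hf, rfl⟩)

/-- The universal `π`-derivation `J_n A → J_{n+1} A`, induced by `polyDelta`. -/
noncomputable def jetDelta (n : ℕ) (y : JetAlg δ I n) : JetAlg δ I (n + 1) :=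
  (jetHom δ I n y).snd

theorem jetDelta_mk (n : ℕ) (f : JetPoly R σ n) :
    jetDelta δ I n (Ideal.Quotient.mk _ f) = Ideal.Quotient.mk _ (polyDelta δ σ n f) := rfl

theorem jetHom_fst (n : ℕ) (y : JetAlg δ I n) :
    (jetHom δ I n y).fst = jetIncl δ I n.le_succ y := by
  obtain ⟨f, rfl⟩ := Ideal.Quotient.mk_surjective y
  exact congrArg (Ideal.Quotient.mk (jetIdeal δ I (n + 1))) (polyHom_fst δ σ n f)

/-- The pair `(u, δ)` is a prolongation `J_n A → J_{n+1} A`. -/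
noncomputable def jetProlongation (n : ℕ) : Prolongation δ (jetIncl δ I n.le_succ) where
  toFun := jetDelta δ I n
  map_base r := congrArg (Ideal.Quotient.mk (jetIdeal δ I (n + 1)))
    ((polyProlongation δ σ n).map_base r)
  map_add x y := by
    rw [jetDelta, _root_.map_add, W1.snd_add, jetHom_fst, jetHom_fst]; rfl
  map_mul x y := by
    rw [jetDelta, _root_.map_mul, W1.snd_mul, jetHom_fst, jetHom_fst]; rfl

/-- The iterate `φ^j : J_k A → J_{k+j} A` of the Frobenius lift `φ y = u(y) ^ q + π δ(y)`. -/
noncomputable def jetFrobIter (k : ℕ) (y : JetAlg δ I k) : (j : ℕ) → JetAlg δ I (k + j)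
  | 0 => y
  | j + 1 => frob π R (jetIncl δ I (Nat.le_succ (k + j))) (jetDelta δ I (k + j))
      (jetFrobIter k y j)

/-- The evaluation `x_s⁽ʲ⁾ ↦ δ^j (a_s)`. -/
noncomputable def polyPoint (a : σ → R) (n : ℕ) : JetPoly R σ n →ₐ[R] R :=
  aeval fun v => δ.toFun^[v.2] (a v.1)

theorem polyPoint_delta (a : σ → R) (n : ℕ) (f : JetPoly R σ n) :
    polyPoint δ a (n + 1) (polyDelta δ σ n f) = δ.toFun (polyPoint δ a n f) := by
  have : (W1.map (polyPoint δ a (n + 1))).comp (polyHom δ σ n) =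
      (δ.hom R).comp (polyPoint δ a n).toRingHom := by
    apply MvPolynomial.ringHom_ext
    · intro r
      simp [polyHom, PiDerivation.hom, algebraMap_eq, polyPoint, W1.map]
    · intro v
      apply W1.ext
      · simp [polyHom, polyPoint, W1.map, PiDerivation.hom]
      · simp [polyHom, polyPoint, W1.map, PiDerivation.hom, Function.iterate_succ_apply']
  exact congrArg W1.snd (congrArg (fun g => g f) this)

theorem polyPoint_iter (a : σ → R) (f : MvPolynomial σ R) (i : ℕ) :
    polyPoint δ a i (polyIter δ σ f i) = δ.toFun^[i] (aeval a f) := by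
  induction i with
  | zero => simp [polyPoint, polyIter, aeval_rename, Function.comp_def]
  | succ i ih => rw [polyIter, polyPoint_delta, ih, Function.iterate_succ_apply']

theorem polyPoint_incl (a : σ → R) {k l : ℕ} (h : k ≤ l) (f : JetPoly R σ k) :
    polyPoint δ a l (polyIncl R σ h f) = polyPoint δ a k f := by
  rw [polyPoint, polyIncl, aeval_rename]
  rfl

/-- The point `P_m : J_m A → R` induced by the marked point `P : A → R`; it takes `x⁽ʲ⁾` to
`δ^j (P x)`. -/
noncomputable def jetPoint (P : (MvPolynomial σ R ⧸ I) →ₐ[R] R) (m : ℕ) :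
    JetAlg δ I m →ₐ[R] R :=
  Ideal.Quotient.liftₐ (jetIdeal δ I m)
    (polyPoint δ (fun s => P (Ideal.Quotient.mk I (X s))) m) (by
    intro g hg
    change g ∈ RingHom.ker _
    revert g
    change jetIdeal δ I m ≤ _
    rw [jetIdeal, Ideal.span_le]
    rintro _ ⟨i, hi, f, hf, rfl⟩
    change polyPoint δ _ m _ = 0
    have h1 : aeval (fun s => P (Ideal.Quotient.mk I (X s))) f = 0 := by
      have h2 : aeval (fun s => P (Ideal.Quotient.mk I (X s))) =
          P.comp (Ideal.Quotient.mkₐ R I) := by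
        ext s; simp
      rw [h2, AlgHom.comp_apply, Ideal.Quotient.mkₐ_eq_mk, Ideal.Quotient.eq_zero_iff_mem.2 hf,
        map_zero]
    rw [polyPoint_incl, polyPoint_iter, h1]
    clear h1 hf
    induction i with
    | zero => rfl
    | succ i ih => rw [Function.iterate_succ_apply', ih (by omega), δ.map_zero])

end Jet

section Kernel

variable {R : Type*} [CommRing R]

/-- The tensor product `B ⊗_J R` along `R`-algebra homomorphisms `u : J → B` and `p : J → R`;
its spectrum is the fibre of `Spec u` over the section `Spec p`. -/
def Fibre {J B : Type*} [CommRing J] [Algebra R J] [CommRing B] [Algebra R B]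
    (u : J →ₐ[R] B) (p : J →ₐ[R] R) : Type _ :=
  letI := u.toRingHom.toAlgebra
  letI := p.toRingHom.toAlgebra
  TensorProduct J B R

namespace Fibre

variable {J B : Type*} [CommRing J] [Algebra R J] [CommRing B] [Algebra R B]
  (u : J →ₐ[R] B) (p : J →ₐ[R] R)

noncomputable instance instCommRing : CommRing (Fibre u p) :=
  @Algebra.TensorProduct.instCommRing J B R _ _ u.toRingHom.toAlgebra _ p.toRingHom.toAlgebra

/-- `Fibre u p` is an `R`-algebra by `r ↦ 1 ⊗ r`. -/
noncomputable instance instAlgebra : Algebra R (Fibre u p) :=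
  letI := u.toRingHom.toAlgebra
  letI := p.toRingHom.toAlgebra
  (Algebra.TensorProduct.includeRight (R := J) (A := B) (B := R)).toRingHom.toAlgebra

/-- The map `b ↦ b ⊗ 1`. -/
noncomputable def incl : B →ₐ[R] Fibre u p :=
  letI := u.toRingHom.toAlgebra
  letI := p.toRingHom.toAlgebra
  { (Algebra.TensorProduct.includeLeftRingHom : B →+* TensorProduct J B R) with
    commutes' := fun r => by
      change (algebraMap R B r) ⊗ₜ[J] (1 : R) = (1 : B) ⊗ₜ[J] r
      have h1 : algebraMap R B r = (algebraMap R J r) • (1 : B) := by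
        rw [Algebra.smul_def, mul_one]
        exact (u.commutes r).symm
      have h2 : r = (algebraMap R J r) • (1 : R) := by
        rw [Algebra.smul_def, mul_one]
        exact (p.commutes r).symm
      conv_rhs => rw [h2]
      rw [h1, TensorProduct.smul_tmul] }

/-- The map `B ⊗_J R → B' ⊗_J R` induced by an `R`-algebra homomorphism `v : B → B'` under `J`. -/
noncomputable def map {B' : Type*} [CommRing B'] [Algebra R B'] {u : J →ₐ[R] B}
    {u' : J →ₐ[R] B'} (p : J →ₐ[R] R) (v : B →ₐ[R] B') (h : v.comp u = u') :
    Fibre u p →ₐ[R] Fibre u' p :=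
  letI := u.toRingHom.toAlgebra
  letI := u'.toRingHom.toAlgebra
  letI := p.toRingHom.toAlgebra
  { (Algebra.TensorProduct.map
      ({ v.toRingHom with commutes' := fun j => congrArg (fun g => g j) h } : B →ₐ[J] B')
      (AlgHom.id J R)).toRingHom with
    commutes' := fun r => by
      change Algebra.TensorProduct.map _ _ ((1 : B) ⊗ₜ[J] r) = (1 : B') ⊗ₜ[J] r
      rw [Algebra.TensorProduct.map_tmul, _root_.map_one]
      rfl }

end Fibre

variable {O : Type*} [CommRing O] [IsDomain O] {π : O} [Fact (Prime π)]
  [Finite (O ⧸ Ideal.span {π})] [Algebra O R] {σ : Type*}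
  (δ : PiDerivation π R) (I : Ideal (MvPolynomial σ R)) (P : (MvPolynomial σ R ⧸ I) →ₐ[R] R)

/-- The kernel algebra `N_{[m]n} A = J_{m+n} A ⊗_{J_m A} R` of the pair `(A, P)`, where
`A = R[x] / I` and `J_m A → R` is the point `P_m`. -/
abbrev KerAlg (m n : ℕ) : Type _ :=
  Fibre (jetIncl δ I (Nat.le_add_right m n)) (jetPoint δ I P m)

/-- The canonical map `i : J_{m+n} A → N_{[m]n} A`. -/
noncomputable def kerProj (m n : ℕ) : JetAlg δ I (m + n) →ₐ[R] KerAlg δ I P m n :=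
  Fibre.incl _ _

/-- The canonical map `u : N_{[m]n} A → N_{[m]n+1} A`. -/
noncomputable def kerIncl (m n : ℕ) : KerAlg δ I P m n →ₐ[R] KerAlg δ I P m (n + 1) :=
  Fibre.map _ (jetIncl δ I (Nat.le_succ (m + n))) (by
    refine Ideal.Quotient.algHom_ext _ ?_
    ext f
    exact congrArg (Ideal.Quotient.mk (jetIdeal δ I (m + (n + 1))))
      (polyIncl_trans (Nat.le_add_right m n) (Nat.le_succ (m + n)) (X f)))

end Kernel

end PiJet

namespace PiJet

set_option linter.unusedSectionVars false

open MvPolynomial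

/-! ### Length-two Witt vectors as an `R`-algebra, and their ghost map -/

section WittAlgebra

variable {O : Type*} [CommRing O] {π : O} {R : Type*} [CommRing R] [Algebra O R]

/-! A `π`-derivation `d` with respect to `u` that extends `δ` is the same as an `R`-algebra map `y ↦
(u y, d y)` to `W₁(C)`, where `R` acts on `W₁(C)` through `r ↦ (r, δ r)`. Call a prolongation
sequence canonical if each term is generated by the images of `u` and `d`, and every compatible
prolongation of a term factors through the next term. Such a sequence is determined by its term of
index zero (`IsCanonical.exists_equiv`), and the jet algebras form one (`jetSeq_isCanonical`). So it
suffices to make the kernel algebras into a canonical sequence with lateral Frobenius lift.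

The operator `δ` need not descend to the fibres, since the ideal of the fibre need not be stable
under it. The substitute comes from `W₁(W₁(B))`. Put `K(a, b) = ((a ^ q + π b) ^ q - a ^ (q ^ 2)) /
π ^ 2`. Sending `((a, b), (c, d))` to `(a, c, d + K(a, b))` is a ring homomorphism onto the Witt
vectors of length three, as ghost components show. Hence in an algebra map to `W₁(W₁(B))` the entry
`(a, b)` may be exchanged for another algebra map `(a, b')`, provided that `d` becomes `d + K(a, b)
- K(a, b')` (`replaceFstHom`). Applied to `y ↦ ((y, δ y), (δ y, δ² y))`, this defines the operator
on the fibres recursively by `Δ(δ y) = δ² y + K(y, δ y) - K(y, Δ y)`, starting from `δ` on `R`,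
which is the fibre of index zero (`exists_lateral`). The formula is the identity `𝔣 φ = φ²` divided
by `π ^ 2`, and it makes sense even if `π` is a zero divisor. The inverse exchange transports the
universal property to the fibres (`seq_isCanonical`).

This step applies to any canonical sequence with a point and returns another one. The fibre of
`J_{n+k} ⊗_{J_{k-1}} R` over the point of `J_k ⊗_{J_{k-1}} R` is `J_{n+k} ⊗_{J_k} R`, so `m + 1`
steps from the jet algebras reach the kernel algebras. Each step raises by one the power of `φ`
needed in the lateral identity. -/

/-- The ring `W₁(B)`, regarded as an `R`-algebra by `r ↦ (r, δ r)`. -/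
def DW (_δ : PiDerivation π R) (B : Type*) : Type _ := W1 π R B

namespace DW

variable {δ : PiDerivation π R} {B : Type*}

/-- The component of index zero. -/
def fst (x : DW δ B) : B := W1.fst x

/-- The component of index one. -/
def snd (x : DW δ B) : B := W1.snd x

/-- The element with given components. -/
def mk (a b : B) : DW δ B := W1.mk a b

@[simp] theorem fst_mk (a b : B) : (mk a b : DW δ B).fst = a := rfl
@[simp] theorem snd_mk (a b : B) : (mk a b : DW δ B).snd = b := rfl

@[ext] theorem ext {x y : DW δ B} (h : x.fst = y.fst) (h' : x.snd = y.snd) : x = y :=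
  W1.ext h h'

variable [IsDomain O] [Fact (Prime π)] [Finite (O ⧸ Ideal.span {π})] [CommRing B] [Algebra R B]

noncomputable instance : CommRing (DW δ B) := inferInstanceAs (CommRing (W1 π R B))

noncomputable instance : Algebra R (DW δ B) := (δ.hom B).toAlgebra

@[simp] theorem fst_add (a b : DW δ B) : (a + b).fst = a.fst + b.fst := rfl
theorem snd_add (a b : DW δ B) : (a + b).snd = a.snd + b.snd + cSum π R a.fst b.fst := rfl
@[simp] theorem fst_mul (a b : DW δ B) : (a * b).fst = a.fst * b.fst := rfl
theorem snd_mul (a b : DW δ B) : (a * b).snd = a.fst ^ resCard π * b.snd +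
    b.fst ^ resCard π * a.snd + piIn π R B * (a.snd * b.snd) := rfl
@[simp] theorem fst_zero : (0 : DW δ B).fst = 0 := rfl
@[simp] theorem snd_zero : (0 : DW δ B).snd = 0 := rfl
@[simp] theorem fst_one : (1 : DW δ B).fst = 1 := rfl
@[simp] theorem snd_one : (1 : DW δ B).snd = 0 := rfl
@[simp] theorem fst_algebraMap (r : R) : (algebraMap R (DW δ B) r).fst = algebraMap R B r := rfl
@[simp] theorem snd_algebraMap (r : R) :
    (algebraMap R (DW δ B) r).snd = algebraMap R B (δ.toFun r) := rfl

variable (δ B) in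
/-- The projection `W₁(B) → B`. -/
noncomputable def fstHom : DW δ B →ₐ[R] B :=
  { (W1.fstHom : W1 π R B →+* B) with commutes' := fun _ => rfl }

@[simp] theorem fstHom_apply (x : DW δ B) : fstHom δ B x = x.fst := rfl

variable {D : Type*} [CommRing D] [Algebra R D]

/-- Functoriality of `W₁`. -/
noncomputable def map (g : B →ₐ[R] D) : DW δ B →ₐ[R] DW δ D :=
  { (W1.map g : W1 π R B →+* W1 π R D) with
    commutes' := fun _ => DW.ext (g.commutes _) (g.commutes _) }

@[simp] theorem fst_map (g : B →ₐ[R] D) (x : DW δ B) : (map g x).fst = g x.fst := rfl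
@[simp] theorem snd_map (g : B →ₐ[R] D) (x : DW δ B) : (map g x).snd = g x.snd := rfl

theorem map_map {E : Type*} [CommRing E] [Algebra R E] (g : B →ₐ[R] D) (h : D →ₐ[R] E)
    (x : DW δ B) : map h (map g x) = map (h.comp g) x := rfl

/-- The ghost component `(a, b) ↦ a ^ q + π b`. -/
noncomputable def ghost (δ : PiDerivation π R) (B : Type*) [CommRing B] [Algebra R B] :
    DW δ B →+* B where
  toFun x := x.fst ^ resCard π + piIn π R B * x.snd
  map_one' := by simp
  map_zero' := by simp [(resCard_pos π).ne']
  map_mul' a b := by rw [snd_mul, fst_mul]; ring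
  map_add' a b := by
    rw [snd_add, fst_add]
    linear_combination pi_mul_cSum π R a.fst b.fst

theorem ghost_apply (x : DW δ B) :
    ghost δ B x = x.fst ^ resCard π + piIn π R B * x.snd := rfl

/-- The Frobenius lift of `O` is the identity. -/
theorem ghost_algebraMap (c : O) : ghost δ B (algebraMap R (DW δ B) (algebraMap O R c)) =
    algebraMap R B (algebraMap O R c) := by
  rw [ghost_apply, fst_algebraMap, snd_algebraMap, δ.map_base, piIn, ← map_pow, ← map_pow,
    ← RingHom.map_mul, ← RingHom.map_mul, mul_divPi (dvd_sub_pow π c), ← RingHom.map_add,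
    ← RingHom.map_add]
  congr 2
  ring

theorem ghost_piIn : ghost δ B (piIn π R (DW δ B)) = piIn π R B := ghost_algebraMap _

/-- Functoriality of `W₁` for semilinear maps. -/
noncomputable def mapRing {S : Type*} [CommRing S] [Algebra O S] {δ' : PiDerivation π S}
    {E : Type*} [CommRing E] [Algebra S E] (g : B →+* E)
    (hg : ∀ c : O, g (algebraMap R B (algebraMap O R c)) = algebraMap S E (algebraMap O S c)) :
    DW δ B →+* DW δ' E where
  toFun a := mk (g a.fst) (g a.snd)
  map_one' := DW.ext (map_one g) (map_zero g)
  map_zero' := DW.ext (map_zero g) (map_zero g)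
  map_mul' a b := DW.ext (map_mul g _ _) (by
    simp only [snd_mul, snd_mk, fst_mk, _root_.map_add, _root_.map_mul, map_pow]
    rw [piIn, piIn, hg])
  map_add' a b := DW.ext (map_add g _ _) (by
    simp only [snd_add, snd_mk, fst_mk, _root_.map_add, cSum_map π R S g hg])

/-- This is the hypothesis `hg` for `mapRing` itself, so that `mapRing` can be iterated on
`W₁(W₁(B))`. -/
theorem mapRing_base {S : Type*} [CommRing S] [Algebra O S] {δ' : PiDerivation π S}
    {E : Type*} [CommRing E] [Algebra S E] (g : B →+* E)
    (hg : ∀ c : O, g (algebraMap R B (algebraMap O R c)) = algebraMap S E (algebraMap O S c))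
    (c : O) : mapRing (δ := δ) (δ' := δ') g hg (algebraMap R _ (algebraMap O R c)) =
      algebraMap S _ (algebraMap O S c) :=
  DW.ext (hg c) (by
    change g (algebraMap R B (δ.toFun _)) = algebraMap S E (δ'.toFun _)
    rw [δ.map_base, δ'.map_base, hg])

end DW

end WittAlgebra

/-! ### The polynomial `K` and the `π`-derivation of `O` -/

section Twist

variable {O : Type*} [CommRing O] [IsDomain O] (π : O) [Fact (Prime π)]
  [Finite (O ⧸ Ideal.span {π})]
  (R : Type*) [CommRing R] [Algebra O R] {B : Type*} [CommRing B] [Algebra R B]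

theorem two_le_resCard : 2 ≤ resCard π := by
  obtain ⟨p, n, hp, hn, h, -⟩ := exists_prime_pow π
  rw [h]
  exact hp.two_le.trans (Nat.le_self_pow hn p)

/-- The value at `(a, b)` of the polynomial `((X ^ q + π Y) ^ q - X ^ (q ^ 2)) / π ^ 2`. -/
noncomputable def kSum (a b : B) : B :=
  piIn π R B ^ (resCard π - 2) * b ^ resCard π + ∑ i ∈ Finset.Ioo 0 (resCard π),
    algebraMap R B (algebraMap O R (divPi π ((resCard π).choose i : O))) *
      ((a ^ resCard π) ^ i * (piIn π R B ^ (resCard π - i - 1) * b ^ (resCard π - i)))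

/-- In the expansion of the power, a mixed term has one factor `π` from the binomial coefficient and
another from `(π b) ^ (q - i)`, while the pure term `(π b) ^ q` is divisible by `π ^ 2` because `q ≥
2`. `kSum` collects the terms already divided, since `π` may be a zero divisor in `B`. -/
theorem pi_sq_mul_kSum (a b : B) : piIn π R B ^ 2 * kSum π R a b =
    (a ^ resCard π + piIn π R B * b) ^ resCard π - (a ^ resCard π) ^ resCard π := by
  have hq := two_le_resCard π
  have h1 : piIn π R B * ∑ i ∈ Finset.Ioo 0 (resCard π),
      algebraMap R B (algebraMap O R (divPi π ((resCard π).choose i : O))) *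
      ((a ^ resCard π) ^ i * (piIn π R B ^ (resCard π - i - 1) * b ^ (resCard π - i))) =
      - cSum π R (a ^ resCard π) (piIn π R B * b) := by
    rw [cSum, neg_neg, Finset.mul_sum]
    refine Finset.sum_congr rfl fun i hi => ?_
    rw [Finset.mem_Ioo] at hi
    have : piIn π R B ^ (resCard π - i) = piIn π R B ^ (resCard π - i - 1) * piIn π R B := by
      rw [← pow_succ]; congr 1; omega
    rw [mul_pow, this]
    ring
  have h2 : piIn π R B ^ resCard π = piIn π R B ^ (resCard π - 2) * piIn π R B ^ 2 := by
    rw [← pow_add]; congr 1; omega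
  have h3 := pi_mul_cSum π R (a ^ resCard π) (piIn π R B * b)
  rw [mul_pow, h2] at h3
  rw [kSum]
  linear_combination piIn π R B * h1 - h3

theorem kSum_map (S : Type*) [CommRing S] [Algebra O S] {D : Type*} [CommRing D] [Algebra S D]
    (g : B →+* D)
    (hg : ∀ c : O, g (algebraMap R B (algebraMap O R c)) = algebraMap S D (algebraMap O S c))
    (x y : B) : g (kSum π R x y) = kSum π S (g x) (g y) := by
  simp [kSum, hg, piIn]

theorem kSum_map_algHom {D : Type*} [CommRing D] [Algebra R D] (g : B →ₐ[R] D) (x y : B) :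
    g (kSum π R x y) = kSum π R (g x) (g y) :=
  kSum_map π R R g.toRingHom (fun _ => g.commutes _) x y

/-- The `π`-derivation of `O` itself. -/
noncomputable def PiDerivation.base : PiDerivation π O where
  toFun c := divPi π (c - c ^ resCard π)
  map_base _ := rfl
  map_add x y := by
    have hp : Prime π := Fact.out
    apply mul_left_cancel₀ hp.ne_zero
    have h := pi_mul_cSum π O (B := O) x y
    change π * cSum π O x y = _ at h
    rw [mul_add, mul_add, mul_divPi (dvd_sub_pow π _), mul_divPi (dvd_sub_pow π _),
      mul_divPi (dvd_sub_pow π _), h]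
    ring
  map_mul x y := by
    have hp : Prime π := Fact.out
    apply mul_left_cancel₀ hp.ne_zero
    have hx := mul_divPi (dvd_sub_pow π x)
    have hy := mul_divPi (dvd_sub_pow π y)
    have hxy := mul_divPi (dvd_sub_pow π (x * y))
    change _ = π * (_ + π * (_ * _))
    linear_combination hxy - x ^ resCard π * hy - y ^ resCard π * hx
      - π * divPi π (y - y ^ resCard π) * hx - (x - x ^ resCard π) * hy

end Twist

/-! ### Exchanging the component of index zero in `W₁(W₁(B))` -/

section Congruence

variable {O : Type*} [CommRing O] [IsDomain O] {π : O} [Fact (Prime π)]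
  [Finite (O ⧸ Ideal.span {π})]
  {R : Type*} [CommRing R] [Algebra O R] {δ : PiDerivation π R}

/-- The congruence on `W₁(W₁(B))` of the elements with the same ghost components
`a`, `a ^ q + π c` and `a ^ (q ^ 2) + π c ^ q + π ^ 2 (d + K(a, b))`. -/
structure DW.Rel {B : Type*} [CommRing B] [Algebra R B] (x y : DW δ (DW δ B)) : Prop where
  fst_fst : x.fst.fst = y.fst.fst
  snd_fst : x.snd.fst = y.snd.fst
  snd_snd : x.snd.snd + kSum π R x.fst.fst x.fst.snd = y.snd.snd + kSum π R y.fst.fst y.fst.snd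

namespace DW

theorem ghost_ghost {B : Type*} [CommRing B] [Algebra R B] (x : DW δ (DW δ B)) :
    ghost δ B (ghost δ (DW δ B) x) = (x.fst.fst ^ resCard π) ^ resCard π +
      piIn π R B * x.snd.fst ^ resCard π +
      piIn π R B ^ 2 * (x.snd.snd + kSum π R x.fst.fst x.fst.snd) := by
  rw [ghost_apply x, RingHom.map_add, RingHom.map_mul, RingHom.map_pow, ghost_piIn, mul_add,
    pi_sq_mul_kSum, ghost_apply, ghost_apply]
  ring

theorem fst_ghost {B : Type*} [CommRing B] [Algebra R B] (x : DW δ (DW δ B)) :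
    (ghost δ (DW δ B) x).fst = x.fst.fst ^ resCard π + piIn π R B * x.snd.fst := by
  rw [ghost_apply, ← fstHom_apply, _root_.map_add, _root_.map_mul, map_pow]
  rfl

/-- Where `π` is a nonzerodivisor, congruence is equality of three of the four ghost components of
`W₁(W₁(B))`. These are ring homomorphisms, so compatibility with sums and products is immediate
there. -/
theorem rel_iff {B : Type*} [CommRing B] [Algebra R B] [IsDomain B] (h : piIn π R B ≠ 0)
    (x y : DW δ (DW δ B)) : Rel x y ↔ x.fst.fst = y.fst.fst ∧
      (ghost δ (DW δ B) x).fst = (ghost δ (DW δ B) y).fst ∧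
      ghost δ B (ghost δ (DW δ B) x) = ghost δ B (ghost δ (DW δ B) y) := by
  rw [fst_ghost, fst_ghost, ghost_ghost, ghost_ghost]
  constructor
  · rintro ⟨h1, h2, h3⟩
    rw [h3, h1, h2]
    exact ⟨rfl, rfl, rfl⟩
  · rintro ⟨h1, h2, h3⟩
    rw [h1] at h2
    have h4 := mul_left_cancel₀ h (add_left_cancel h2)
    rw [h1, h4] at h3
    refine ⟨h1, h4, ?_⟩
    have h5 := mul_left_cancel₀ (pow_ne_zero 2 h) (add_left_cancel h3)
    rwa [← h1] at h5 ⊢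

theorem Rel.add_of_isDomain {B : Type*} [CommRing B] [Algebra R B] [IsDomain B]
    (h : piIn π R B ≠ 0) {x y x' y' : DW δ (DW δ B)} (h1 : Rel x y) (h2 : Rel x' y') :
    Rel (x + x') (y + y') := by
  rw [rel_iff h] at *
  simp only [_root_.map_add, fst_add, h1, h2, and_self]

theorem Rel.mul_of_isDomain {B : Type*} [CommRing B] [Algebra R B] [IsDomain B]
    (h : piIn π R B ≠ 0) {x y x' y' : DW δ (DW δ B)} (h1 : Rel x y) (h2 : Rel x' y') :
    Rel (x * x') (y * y') := by
  rw [rel_iff h] at *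
  simp only [_root_.map_mul, fst_mul, h1, h2, and_self]

variable {B : Type*} [CommRing B] [Algebra R B]

/-- Two pairs of congruent elements come from a polynomial ring over `O`. -/
theorem Rel.exists_lift {x y x' y' : DW δ (DW δ B)} (h1 : Rel x y) (h2 : Rel x' y') :
    ∃ (g : DW (.base π) (DW (.base π) (MvPolynomial (Fin 10) O)) →+* DW δ (DW δ B))
      (a b a' b' : _), Rel a b ∧ Rel a' b' ∧ g a = x ∧ g b = y ∧ g a' = x' ∧ g b' = y' ∧
      ∀ c d, Rel c d → Rel (g c) (g d) := by
  -- A congruent pair has five free coordinates: the four of its first member and the `b`-entry of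
  -- the second. The remaining entries of the second are forced. Two pairs thus need ten variables.
  let e : MvPolynomial (Fin 10) O →+* B := eval₂Hom ((algebraMap R B).comp (algebraMap O R))
    ![x.fst.fst, x.fst.snd, x.snd.fst, x.snd.snd, y.fst.snd,
      x'.fst.fst, x'.fst.snd, x'.snd.fst, x'.snd.snd, y'.fst.snd]
  have he : ∀ c : O, e (algebraMap O _ (algebraMap O O c)) =
      algebraMap R B (algebraMap O R c) := by
    intro c; simp [e, algebraMap_eq]
  have hk (a b) : e (kSum π O a b) = kSum π R (e a) (e b) := kSum_map π O R e he a b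
  let e1 : DW (.base π) (MvPolynomial (Fin 10) O) →+* DW δ B := mapRing e he
  refine ⟨mapRing e1 (mapRing_base e he),
    DW.mk (DW.mk (X 0) (X 1)) (DW.mk (X 2) (X 3)),
    DW.mk (DW.mk (X 0) (X 4)) (DW.mk (X 2) (X 3 + kSum π O (X 0) (X 1) - kSum π O (X 0) (X 4))),
    DW.mk (DW.mk (X 5) (X 6)) (DW.mk (X 7) (X 8)),
    DW.mk (DW.mk (X 5) (X 9)) (DW.mk (X 7) (X 8 + kSum π O (X 5) (X 6) - kSum π O (X 5) (X 9))),
    ⟨rfl, rfl, ?_⟩, ⟨rfl, rfl, ?_⟩, ?_, ?_, ?_, ?_, ?_⟩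
  · simp
  · simp
  · ext <;> simp [mapRing, e1, e]
  · ext
    · simp [mapRing, e1, e, h1.fst_fst]
    · simp [mapRing, e1, e]
    · simp [mapRing, e1, e, h1.snd_fst]
    · have := h1.snd_snd
      rw [← h1.fst_fst] at this
      simp only [mapRing, e1, RingHom.coe_mk, MonoidHom.coe_mk, OneHom.coe_mk, snd_mk,
        map_sub, _root_.map_add, hk]
      simp only [e, coe_eval₂Hom, eval₂_X]
      change x.snd.snd + kSum π R x.fst.fst x.fst.snd - kSum π R x.fst.fst y.fst.snd = y.snd.snd
      linear_combination this
  · ext <;> simp [mapRing, e1, e]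
  · ext
    · simp [mapRing, e1, e, h2.fst_fst]
    · simp [mapRing, e1, e]
    · simp [mapRing, e1, e, h2.snd_fst]
    · have := h2.snd_snd
      rw [← h2.fst_fst] at this
      simp only [mapRing, e1, RingHom.coe_mk, MonoidHom.coe_mk, OneHom.coe_mk, snd_mk,
        map_sub, _root_.map_add, hk]
      simp only [e, coe_eval₂Hom, eval₂_X]
      change x'.snd.snd + kSum π R x'.fst.fst x'.fst.snd - kSum π R x'.fst.fst y'.fst.snd =
        y'.snd.snd
      linear_combination this
  · rintro c d ⟨h1, h2, h3⟩
    refine ⟨congrArg e h1, congrArg e h2, ?_⟩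
    have := congrArg e h3
    rw [RingHom.map_add, RingHom.map_add, hk, hk] at this
    exact this

theorem piIn_mvPolynomial_ne_zero : piIn π O (MvPolynomial (Fin 10) O) ≠ 0 := by
  have hp : Prime π := Fact.out
  rw [piIn]
  simpa [algebraMap_eq] using hp.ne_zero

/-- The polynomial identities behind the statement are checked over `O`, where `π` is cancellable,
and then specialized. -/
theorem Rel.add {x y x' y' : DW δ (DW δ B)} (h1 : Rel x y) (h2 : Rel x' y') :
    Rel (x + x') (y + y') := by
  obtain ⟨g, a, b, a', b', h, h', rfl, rfl, rfl, rfl, hg⟩ := h1.exists_lift h2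
  rw [← RingHom.map_add, ← RingHom.map_add]
  exact hg _ _ (h.add_of_isDomain piIn_mvPolynomial_ne_zero h')

theorem Rel.mul {x y x' y' : DW δ (DW δ B)} (h1 : Rel x y) (h2 : Rel x' y') :
    Rel (x * x') (y * y') := by
  obtain ⟨g, a, b, a', b', h, h', rfl, rfl, rfl, rfl, hg⟩ := h1.exists_lift h2
  rw [← RingHom.map_mul, ← RingHom.map_mul]
  exact hg _ _ (h.mul_of_isDomain piIn_mvPolynomial_ne_zero h')

theorem Rel.symm {x y : DW δ (DW δ B)} (h : Rel x y) : Rel y x :=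
  ⟨h.1.symm, h.2.symm, h.3.symm⟩

theorem Rel.trans {x y z : DW δ (DW δ B)} (h : Rel x y) (h' : Rel y z) : Rel x z :=
  ⟨h.1.trans h'.1, h.2.trans h'.2, h.3.trans h'.3⟩

theorem Rel.eq_of_fst_eq {x y : DW δ (DW δ B)} (h : Rel x y) (h' : x.fst = y.fst) : x = y := by
  refine DW.ext h' (DW.ext h.2 ?_)
  have := h.3
  rw [h'] at this
  exact add_right_cancel this

/-- The element congruent to `x` whose component of index zero is `w`. -/
noncomputable def replaceFst (x : DW δ (DW δ B)) (w : DW δ B) : DW δ (DW δ B) :=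
  mk w (mk x.snd.fst
    (x.snd.snd + kSum π R x.fst.fst x.fst.snd - kSum π R w.fst w.snd))

theorem replaceFst_rel {x : DW δ (DW δ B)} {w : DW δ B} (h : w.fst = x.fst.fst) :
    Rel (replaceFst x w) x :=
  ⟨h, rfl, sub_add_cancel _ _⟩

theorem replaceFst_self (x : DW δ (DW δ B)) : replaceFst x x.fst = x :=
  (replaceFst_rel rfl).eq_of_fst_eq rfl

/-- An algebra homomorphism to `W₁(W₁(B))` stays one when its component of index zero is
replaced within the congruence class. -/
noncomputable def replaceFstHom {S : Type*} [CommRing S] [Algebra R S]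
    (f : S →ₐ[R] DW δ (DW δ B)) (w : S →ₐ[R] DW δ B) (h : ∀ s, (w s).fst = (f s).fst.fst) :
    S →ₐ[R] DW δ (DW δ B) where
  toFun s := replaceFst (f s) (w s)
  map_one' := by
    rw [_root_.map_one, _root_.map_one]; exact replaceFst_self 1
  map_zero' := by
    rw [_root_.map_zero, _root_.map_zero]; exact replaceFst_self 0
  map_add' s t := by
    -- An element is determined by its class and its component of index zero. The component is
    -- additive because `w` is, the class because `f` and the congruence are.
    refine Rel.eq_of_fst_eq ?_ (_root_.map_add w s t)
    refine (replaceFst_rel (h _)).trans ?_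
    rw [_root_.map_add]
    exact ((replaceFst_rel (h _)).add (replaceFst_rel (h _))).symm
  map_mul' s t := by
    refine Rel.eq_of_fst_eq ?_ (_root_.map_mul w s t)
    refine (replaceFst_rel (h _)).trans ?_
    rw [_root_.map_mul]
    exact ((replaceFst_rel (h _)).mul (replaceFst_rel (h _))).symm
  commutes' r := by
    rw [AlgHom.commutes, AlgHom.commutes]; exact replaceFst_self (algebraMap R _ r)

end DW

end Congruence

/-! ### Prolongation sequences and their universal property -/

section Sequences

universe v w

variable {O : Type*} [CommRing O] [IsDomain O] {π : O} [Fact (Prime π)]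
  [Finite (O ⧸ Ideal.span {π})]
  {R : Type*} [CommRing R] [Algebra O R]

/-- A prolongation sequence of `R`-algebras, given by the homomorphisms `y ↦ (u y, d y)`. -/
structure PSeq (δ : PiDerivation π R) where
  /-- The terms of the sequence. -/
  obj : ℕ → Type v
  [commRing : ∀ n, CommRing (obj n)]
  [algebra : ∀ n, Algebra R (obj n)]
  /-- The homomorphism `y ↦ (u y, d y)`. -/
  hom : ∀ n, obj n →ₐ[R] DW δ (obj (n + 1))
  comm : ∀ n, (hom (n + 1)).comp ((DW.fstHom δ _).comp (hom n)) =
    (DW.map ((DW.fstHom δ _).comp (hom (n + 1)))).comp (hom n)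

namespace PSeq

attribute [instance] PSeq.commRing PSeq.algebra

variable {δ : PiDerivation π R} (S : PSeq.{v} δ)

/-- The transition maps `u`. -/
noncomputable def incl (n : ℕ) : S.obj n →ₐ[R] S.obj (n + 1) :=
  (DW.fstHom δ _).comp (S.hom n)

theorem fst_hom (n : ℕ) (y : S.obj n) : (S.hom n y).fst = S.incl n y := rfl

theorem hom_incl (n : ℕ) (y : S.obj n) :
    S.hom (n + 1) (S.incl n y) = DW.map (S.incl (n + 1)) (S.hom n y) :=
  DFunLike.congr_fun (S.comm n) y

/-- The operator `d`. -/
noncomputable def der (n : ℕ) (y : S.obj n) : S.obj (n + 1) := (S.hom n y).snd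

theorem snd_hom (n : ℕ) (y : S.obj n) : (S.hom n y).snd = S.der n y := rfl

theorem der_incl (n : ℕ) (y : S.obj n) :
    S.der (n + 1) (S.incl n y) = S.incl (n + 1) (S.der n y) :=
  congrArg DW.snd (S.hom_incl n y)

/-- The Frobenius lift `y ↦ u(y) ^ q + π d(y)`. -/
noncomputable def frob (n : ℕ) : S.obj n →+* S.obj (n + 1) :=
  (DW.ghost δ _).comp (S.hom n).toRingHom

theorem frob_apply (n : ℕ) (y : S.obj n) : S.frob n y =
    S.incl n y ^ resCard π + piIn π R (S.obj (n + 1)) * S.der n y := rfl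

/-- Compatibility of a prolongation of the `n`-th term with the previous one. -/
def Compat {C : Type*} [CommRing C] [Algebra R C] : ∀ n, (S.obj n →ₐ[R] DW δ C) → Prop
  | 0, _ => True
  | n + 1, E => E.comp (S.incl n) = (DW.map ((DW.fstHom δ C).comp E)).comp (S.hom n)

/-- The sequence is freely generated by its term of index zero. -/
structure IsCanonical : Prop where
  gen (n : ℕ) : Algebra.adjoin R (Set.range (S.incl n) ∪ Set.range (S.der n)) = ⊤
  -- Only existence is required, as uniqueness of `g` follows from `gen`. The test algebras live in
  -- a fixed universe `w`, which is why it is a parameter.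
  ex (n : ℕ) (C : Type w) [CommRing C] [Algebra R C] (E : S.obj n →ₐ[R] DW δ C)
    (hE : S.Compat n E) : ∃ g : S.obj (n + 1) →ₐ[R] C, (DW.map g).comp (S.hom n) = E

variable {S}

theorem IsCanonical.hom_ext (hS : IsCanonical.{v, w} S) {n : ℕ} {C : Type*} [CommRing C]
    [Algebra R C] {g h : S.obj (n + 1) →ₐ[R] C}
    (h1 : ∀ y, g (S.incl n y) = h (S.incl n y)) (h2 : ∀ y, g (S.der n y) = h (S.der n y)) :
    g = h := by
  refine AlgHom.ext_of_adjoin_eq_top (hS.gen n) ?_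
  rintro _ (⟨y, rfl⟩ | ⟨y, rfl⟩)
  · exact h1 y
  · exact h2 y

end PSeq

end Sequences

/-! ### The jet algebras form a canonical sequence -/

section JetSequence

universe w

variable {O : Type*} [CommRing O] [IsDomain O] {π : O} [Fact (Prime π)]
  [Finite (O ⧸ Ideal.span {π})]
  {R : Type*} [CommRing R] [Algebra O R] (δ : PiDerivation π R) {σ : Type*}
  (I : Ideal (MvPolynomial σ R))

theorem jetIncl_mk {k l : ℕ} (h : k ≤ l) (f : JetPoly R σ k) :
    jetIncl δ I h (Ideal.Quotient.mk _ f) = Ideal.Quotient.mk _ (polyIncl R σ h f) := rfl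

theorem jetIncl_trans {j k l : ℕ} (h : j ≤ k) (h' : k ≤ l) (y : JetAlg δ I j) :
    jetIncl δ I h' (jetIncl δ I h y) = jetIncl δ I (h.trans h') y := by
  obtain ⟨f, rfl⟩ := Ideal.Quotient.mk_surjective y
  rw [jetIncl_mk, jetIncl_mk, jetIncl_mk, polyIncl_trans]

theorem polyIncl_self {k : ℕ} (f : JetPoly R σ k) : polyIncl R σ le_rfl f = f :=
  rename_id_apply f

theorem jetIncl_self {k : ℕ} (y : JetAlg δ I k) : jetIncl δ I le_rfl y = y := by
  obtain ⟨f, rfl⟩ := Ideal.Quotient.mk_surjective y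
  rw [jetIncl_mk, polyIncl_self]

theorem jetDelta_incl {k l : ℕ} (h : k ≤ l) (y : JetAlg δ I k) :
    jetDelta δ I l (jetIncl δ I h y) =
      jetIncl δ I (Nat.succ_le_succ h) (jetDelta δ I k y) := by
  obtain ⟨f, rfl⟩ := Ideal.Quotient.mk_surjective y
  rw [jetIncl_mk, jetDelta_mk, jetDelta_mk, jetIncl_mk, polyDelta_incl]

/-- The homomorphism `f ↦ (f, δ f)` on polynomials. -/
noncomputable def polyAlgHom (σ : Type*) (n : ℕ) :
    JetPoly R σ n →ₐ[R] DW δ (JetPoly R σ (n + 1)) :=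
  { (polyHom δ σ n : JetPoly R σ n →+* W1 π R (JetPoly R σ (n + 1))) with
    commutes' := fun r => eval₂Hom_C _ _ r }

theorem polyAlgHom_X (n : ℕ) (v : σ × Fin (n + 1)) : polyAlgHom δ σ n (X v) =
    DW.mk (X (v.1, v.2.castSucc)) (X (v.1, v.2.succ)) :=
  eval₂Hom_X' _ _ v

theorem polyAlgHom_fst (n : ℕ) (f : JetPoly R σ n) :
    (polyAlgHom δ σ n f).fst = polyIncl R σ n.le_succ f := polyHom_fst δ σ n f

/-- The canonical prolongation sequence `J_n A`. -/
noncomputable def jetSeq : PSeq δ where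
  obj := JetAlg δ I
  hom n :=
    { (jetHom δ I n : JetAlg δ I n →+* W1 π R (JetAlg δ I (n + 1))) with
      commutes' := fun r => congrArg (DW.map (Ideal.Quotient.mkₐ R (jetIdeal δ I (n + 1))))
        ((polyAlgHom δ σ n).commutes r) }
  comm n := by
    have h (k) (y : JetAlg δ I k) : jetHom δ I k y =
      W1.mk (jetIncl δ I k.le_succ y) (jetDelta δ I k y) := W1.ext (jetHom_fst δ I k y) rfl
    ext y
    · rfl
    · change (jetHom δ I (n + 1) (jetHom δ I n y).fst).snd =
        (jetHom δ I (n + 1) (jetHom δ I n y).snd).fst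
      rw [h n, h (n + 1), h (n + 1)]
      exact jetDelta_incl δ I _ _

theorem jetSeq_incl (n : ℕ) (y : JetAlg δ I n) :
    (jetSeq δ I).incl n y = jetIncl δ I n.le_succ y := jetHom_fst δ I n y

theorem jetSeq_der (n : ℕ) (y : JetAlg δ I n) : (jetSeq δ I).der n y = jetDelta δ I n y := rfl

theorem jetSeq_isCanonical : PSeq.IsCanonical.{_, w} (jetSeq δ I) where
  gen n := by
    set A := Algebra.adjoin R (Set.range ((jetSeq δ I).incl n) ∪ Set.range ((jetSeq δ I).der n))
    have h : (⊤ : Subalgebra R (JetPoly R σ (n + 1))) ≤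
        A.comap (Ideal.Quotient.mkₐ R (jetIdeal δ I (n + 1))) := by
      rw [← MvPolynomial.adjoin_range_X, Algebra.adjoin_le_iff]
      rintro _ ⟨⟨s, j⟩, rfl⟩
      change Ideal.Quotient.mk _ _ ∈ A
      induction j using Fin.lastCases with
      | last =>
        refine Algebra.subset_adjoin (Or.inr ⟨Ideal.Quotient.mk _ (X (s, Fin.last n)), ?_⟩)
        rw [jetSeq_der, jetDelta_mk, polyDelta_X]
        rfl
      | cast j =>
        refine Algebra.subset_adjoin (Or.inl ⟨Ideal.Quotient.mk _ (X (s, j)), ?_⟩)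
        rw [jetSeq_incl, jetIncl_mk, polyIncl, rename_X]
        rfl
    refine top_le_iff.1 fun y _ => ?_
    obtain ⟨f, rfl⟩ := Ideal.Quotient.mk_surjective y
    exact h (Algebra.mem_top (x := f))
  ex n C _ _ E hE := by
    let E' : JetAlg δ I n →ₐ[R] DW δ C := E
    let x (s : σ) (j : Fin (n + 1)) : DW δ C := E' (Ideal.Quotient.mk _ (X (s, j)))
    -- The variables of order at most `n` are dictated by the component of index zero of `E`. The
    -- only new freedom, the variable of order `n + 1`, is taken from the component of index one at
    -- order `n`.
    let G : JetPoly R σ (n + 1) →ₐ[R] C := aeval fun v =>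
      Fin.lastCases (motive := fun _ => C) (x v.1 (Fin.last n)).snd
        (fun j => (x v.1 j).fst) v.2
    -- Compatibility of `E` says that its two components agree on the overlapping orders, so `G`
    -- recovers both of them.
    have hx (s : σ) (j : Fin n) : (x s j.castSucc).snd = (x s j.succ).fst := by
      cases n with
      | zero => exact j.elim0
      | succ n =>
        have h := congrArg DW.snd
          (DFunLike.congr_fun hE (Ideal.Quotient.mk (jetIdeal δ I n) (X (s, j))))
        change (E' ((jetSeq δ I).incl n _)).snd = (E' ((jetSeq δ I).der n _)).fst at h
        rw [jetSeq_der, jetDelta_mk, polyDelta_X, jetSeq_incl, jetIncl_mk, polyIncl,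
          rename_X] at h
        exact h
    have hG : (DW.map G).comp (polyAlgHom δ σ n) = E'.comp (Ideal.Quotient.mkₐ R _) := by
      refine MvPolynomial.algHom_ext fun ⟨s, j⟩ => ?_
      rw [AlgHom.comp_apply, polyAlgHom_X]
      refine DW.ext ?_ ?_
      · change G (X (s, j.castSucc)) = (x s j).fst
        simp [G]
      · change G (X (s, j.succ)) = (x s j).snd
        induction j using Fin.lastCases with
        | last => simp [G]
        | cast j => rw [hx, Fin.succ_castSucc]; simp only [G, aeval_X, Fin.lastCases_castSucc]
    have hG1 (f) : G (polyIncl R σ n.le_succ f) = (E' (Ideal.Quotient.mk _ f)).fst := by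
      rw [← polyAlgHom_fst δ]
      exact congrArg DW.fst (DFunLike.congr_fun hG f)
    have hG2 (f) : G (polyDelta δ σ n f) = (E' (Ideal.Quotient.mk _ f)).snd :=
      congrArg DW.snd (DFunLike.congr_fun hG f)
    have hz (i : ℕ) (h : i ≤ n) (f) (hf : f ∈ I) :
        Ideal.Quotient.mk (jetIdeal δ I n) (polyIncl R σ h (polyIter δ σ f i)) = 0 :=
      Ideal.Quotient.eq_zero_iff_mem.2 (Ideal.subset_span ⟨i, h, f, hf, rfl⟩)
    have hker : jetIdeal δ I (n + 1) ≤ RingHom.ker G := by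
      rw [jetIdeal, Ideal.span_le]
      rintro _ ⟨i, hi, f, hf, rfl⟩
      change G _ = 0
      -- Generators of order at most `n` die through the component of index zero, and the new ones
      -- `δ^(n+1) f` through the component of index one.
      rcases Nat.lt_or_ge n i with h | h
      · obtain rfl : i = n + 1 := by omega
        have h3 := hz n le_rfl f hf
        rw [polyIncl_self] at h3
        rw [polyIncl_self, polyIter, hG2, h3, map_zero, DW.snd_zero]
      · rw [← polyIncl_trans h n.le_succ, hG1, hz i h f hf, map_zero, DW.fst_zero]
    refine ⟨Ideal.Quotient.liftₐ (jetIdeal δ I (n + 1)) G hker, ?_⟩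
    refine Ideal.Quotient.algHom_ext _ ?_
    exact hG

end JetSequence

/-! ### The lateral operator on the fibres of a pointed canonical sequence -/

section Derived

universe v w

variable {O : Type*} [CommRing O] [IsDomain O] {π : O} [Fact (Prime π)]
  [Finite (O ⧸ Ideal.span {π})]
  {R : Type*} [CommRing R] [Algebra O R] {δ : PiDerivation π R}

namespace PSeq

/-- A morphism from a prolongation sequence to the constant sequence `R`. -/
structure Point (S : PSeq.{v} δ) where
  /-- The homomorphisms to `R`. -/
  toHom (n : ℕ) : S.obj n →ₐ[R] R
  incl (n : ℕ) (y : S.obj n) : toHom (n + 1) (S.incl n y) = toHom n y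
  der (n : ℕ) (y : S.obj n) : toHom (n + 1) (S.der n y) = δ.toFun (toHom n y)

namespace Point

variable {S : PSeq.{v} δ} (P : S.Point)

/-- The ideal generated by the kernel of the point of the term of index zero. -/
noncomputable def ideal : ∀ n, Ideal (S.obj n)
  | 0 => RingHom.ker (P.toHom 0)
  | n + 1 => (ideal n).map (S.incl n)

/-- The fibre over the point of the term of index zero. -/
abbrev Quo (n : ℕ) : Type v := S.obj n ⧸ P.ideal n

/-- The projection to the fibre. -/
noncomputable def proj (n : ℕ) : S.obj n →ₐ[R] P.Quo n := Ideal.Quotient.mkₐ R (P.ideal n)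

theorem proj_surjective (n : ℕ) : Function.Surjective (P.proj n) :=
  Ideal.Quotient.mk_surjective

/-- The transition maps between the fibres. -/
noncomputable def quoIncl (n : ℕ) : P.Quo n →ₐ[R] P.Quo (n + 1) :=
  Ideal.quotientMapₐ (P.ideal (n + 1)) (S.incl n) Ideal.le_comap_map

theorem quoIncl_proj (n : ℕ) (y : S.obj n) :
    P.quoIncl n (P.proj n y) = P.proj (n + 1) (S.incl n y) := rfl

theorem proj_zero_eq (y : S.obj 0) : P.proj 0 y = algebraMap R _ (P.toHom 0 y) := by
  rw [← (P.proj 0).commutes, ← sub_eq_zero, ← map_sub]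
  refine Ideal.Quotient.eq_zero_iff_mem.2 ?_
  change P.toHom 0 (_ - _) = 0
  rw [map_sub, AlgHom.commutes]
  exact sub_self _

theorem exists_eq_algebraMap (z : P.Quo 0) : ∃ r : R, z = algebraMap R _ r := by
  obtain ⟨y, rfl⟩ := P.proj_surjective 0 z
  exact ⟨_, P.proj_zero_eq y⟩

theorem ideal_le_ker (n : ℕ) : P.ideal n ≤ RingHom.ker (P.toHom n) := by
  induction n with
  | zero => exact le_rfl
  | succ n ih =>
    rw [ideal, Ideal.map_le_iff_le_comap]
    intro y hy
    exact (P.incl n y).trans (ih hy)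

/-- The induced map from the fibre to `R`. -/
noncomputable def quoHom (n : ℕ) : P.Quo n →ₐ[R] R :=
  Ideal.Quotient.liftₐ (P.ideal n) (P.toHom n) (P.ideal_le_ker n)

theorem quoHom_proj (n : ℕ) (y : S.obj n) : P.quoHom n (P.proj n y) = P.toHom n y := rfl

theorem quoHom_quoIncl (n : ℕ) (z : P.Quo n) :
    P.quoHom (n + 1) (P.quoIncl n z) = P.quoHom n z := by
  obtain ⟨y, rfl⟩ := P.proj_surjective n z
  exact P.incl n y

/-- The recursive relation between the `π`-derivations on the fibres. -/
def Lateral {n : ℕ} (D : P.Quo n →ₐ[R] DW δ (P.Quo (n + 1)))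
    (D' : P.Quo (n + 1) →ₐ[R] DW δ (P.Quo (n + 2))) : Prop :=
  ∀ y : S.obj n, DW.map (D'.comp (P.proj (n + 1))) (S.hom n y) =
    DW.replaceFst (DW.map (DW.map (P.proj (n + 2))) (DW.map (S.hom (n + 1)) (S.hom n y)))
      (DW.map (P.quoIncl (n + 1)) (D (P.proj n y)))

section

variable {P} {n : ℕ} {D : P.Quo n →ₐ[R] DW δ (P.Quo (n + 1))}
  {D' : P.Quo (n + 1) →ₐ[R] DW δ (P.Quo (n + 2))}

theorem Lateral.quoIncl (h : P.Lateral D D') (z : P.Quo n) :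
    D' (P.quoIncl n z) = DW.map (P.quoIncl (n + 1)) (D z) := by
  obtain ⟨y, rfl⟩ := P.proj_surjective n z
  exact congrArg DW.fst (h y)

/-- The working form of laterality: `Δ(δ y) = δ² y + K(y, δ y) - K(y, Δ y)`. -/
theorem Lateral.snd (h : P.Lateral D D') (hD : ∀ z, (D z).fst = P.quoIncl n z)
    (y : S.obj n) : (D' (P.proj (n + 1) (S.der n y))).snd =
      P.proj (n + 2) (S.der (n + 1) (S.der n y)) +
      kSum π R (P.proj (n + 2) (S.incl (n + 1) (S.incl n y)))
        (P.proj (n + 2) (S.incl (n + 1) (S.der n y))) -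
      kSum π R (P.proj (n + 2) (S.incl (n + 1) (S.incl n y)))
        (P.quoIncl (n + 1) (D (P.proj n y)).snd) := by
  refine (congrArg (fun x => x.snd.snd) (h y)).trans ?_
  simp only [DW.replaceFst, DW.snd_mk, DW.snd_map, DW.fst_map, hD, quoIncl_proj, snd_hom,
    fst_hom, der_incl]

/-- The homomorphism that gives the next `π`-derivation. -/
noncomputable def nextHom (D : P.Quo n →ₐ[R] DW δ (P.Quo (n + 1)))
    (hD : ∀ z, (D z).fst = P.quoIncl n z) : S.obj n →ₐ[R] DW δ (DW δ (P.Quo (n + 2))) :=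
  DW.replaceFstHom
    (((DW.map (DW.map (P.proj (n + 2)))).comp (DW.map (S.hom (n + 1)))).comp (S.hom n))
    ((DW.map (P.quoIncl (n + 1))).comp (D.comp (P.proj n)))
    fun s => congrArg (P.quoIncl (n + 1)) (hD (P.proj n s))

theorem nextHom_apply (hD : ∀ z, (D z).fst = P.quoIncl n z) (y : S.obj n) :
    nextHom D hD y =
    DW.replaceFst (DW.map (DW.map (P.proj (n + 2))) (DW.map (S.hom (n + 1)) (S.hom n y)))
      (DW.map (P.quoIncl (n + 1)) (D (P.proj n y))) := rfl

/-- The recursion continues because the value prescribed for `Δ` on `u(δ y) = δ(u y)` is the image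
under `u` of the previous value. This uses laterality one level lower. -/
theorem compat_nextHom (h : P.Lateral D D') (hD : ∀ z, (D z).fst = P.quoIncl n z)
    (hD' : ∀ z, (D' z).fst = P.quoIncl (n + 1) z) : S.Compat (n + 1) (nextHom D' hD') := by
  refine AlgHom.ext fun y => ?_
  change nextHom D' hD' (S.incl n y) = DW.mk (nextHom D' hD' (S.incl n y)).fst
    (nextHom D' hD' (S.der n y)).fst
  refine DW.ext rfl ?_
  rw [DW.snd_mk, nextHom_apply, nextHom_apply]
  refine DW.ext ?_ ?_
  · simp only [DW.replaceFst, DW.snd_mk, DW.fst_mk, DW.snd_map, DW.fst_map, hD', quoIncl_proj,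
      snd_hom, fst_hom, der_incl]
  · have h1 : D' (P.proj (n + 1) (S.incl n y)) = DW.map (P.quoIncl (n + 1)) (D (P.proj n y)) :=
      h.quoIncl (P.proj n y)
    simp only [DW.replaceFst, DW.snd_mk, DW.fst_mk, DW.snd_map, DW.fst_map, hD', quoIncl_proj,
      snd_hom, fst_hom, der_incl, h.snd hD, h1, hD, map_sub, map_add, kSum_map_algHom]

/-- The universal property turns `nextHom D` into a map `g` on the next term. On the image of `u` it
is induced by `D`, which already lives on the fibre, so `g` kills the ideal of the fibre. -/
theorem exists_lateral (hS : IsCanonical.{v, v} S) (hD : ∀ z, (D z).fst = P.quoIncl n z)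
    (hc : S.Compat n (nextHom D hD)) :
    ∃ D' : P.Quo (n + 1) →ₐ[R] DW δ (P.Quo (n + 2)),
      (∀ z, (D' z).fst = P.quoIncl (n + 1) z) ∧ P.Lateral D D' := by
  obtain ⟨g, hg⟩ := hS.ex n _ (nextHom D hD) hc
  have h1 (y) : g (S.incl n y) = DW.map (P.quoIncl (n + 1)) (D (P.proj n y)) :=
    congrArg DW.fst (DFunLike.congr_fun hg y)
  have h2 (y) : g (S.der n y) = (nextHom D hD y).snd :=
    congrArg DW.snd (DFunLike.congr_fun hg y)
  have hker : P.ideal (n + 1) ≤ RingHom.ker g := by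
    rw [ideal, Ideal.map_le_iff_le_comap]
    intro y hy
    change g (S.incl n y) = 0
    have : P.proj n y = 0 := Ideal.Quotient.eq_zero_iff_mem.2 hy
    rw [h1, this, map_zero, map_zero]
  refine ⟨Ideal.Quotient.liftₐ (P.ideal (n + 1)) g hker, fun z => ?_, fun y => ?_⟩
  · obtain ⟨y, rfl⟩ := P.proj_surjective (n + 1) z
    change (g y).fst = P.proj (n + 2) (S.incl (n + 1) y)
    have : (DW.fstHom δ _).comp g = (P.proj (n + 2)).comp (S.incl (n + 1)) := by
      refine hS.hom_ext (fun y => ?_) fun y => ?_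
      · change (g _).fst = _
        rw [h1, DW.fst_map, hD]
        rfl
      · change (g _).fst = _
        rw [h2]
        rfl
    exact DFunLike.congr_fun this y
  · exact DFunLike.congr_fun hg y

end

/-- A compatible family of `π`-derivations on the fibres. -/
structure Lift where
  /-- The homomorphisms `z ↦ (u z, Δ z)`. -/
  hom (n : ℕ) : P.Quo n →ₐ[R] DW δ (P.Quo (n + 1))
  fst (n : ℕ) (z : P.Quo n) : (hom n z).fst = P.quoIncl n z
  lateral (n : ℕ) : P.Lateral (hom n) (hom (n + 1))

theorem nonempty_lift (hS : IsCanonical.{v, v} S) : Nonempty P.Lift := by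
  let H (n : ℕ) := {D : P.Quo n →ₐ[R] DW δ (P.Quo (n + 1)) // ∀ z, (D z).fst = P.quoIncl n z}
  -- The recursion carries two consecutive operators, because constructing the next one needs the
  -- lateral relation between them.
  let T (n : ℕ) := {p : H n × H (n + 1) // P.Lateral p.1.1 p.2.1}
  -- The fibre of index zero is `R`, so its operator can only be `δ`.
  let D0 : H 0 := ⟨(Algebra.ofId R (DW δ (P.Quo 1))).comp (P.quoHom 0), fun z => by
    obtain ⟨r, rfl⟩ := P.exists_eq_algebraMap z
    rw [AlgHom.commutes, AlgHom.commutes]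
    rfl⟩
  obtain ⟨D1, h1, h1'⟩ := exists_lateral (P := P) (D := D0.1) hS D0.2 trivial
  have step (n : ℕ) (t : T n) : ∃ t' : T (n + 1), t'.1.1 = t.1.2 := by
    obtain ⟨D', h, h'⟩ := exists_lateral (P := P) (D := t.1.2.1) hS t.1.2.2
      (compat_nextHom t.2 t.1.1.2 t.1.2.2)
    exact ⟨⟨(t.1.2, ⟨D', h⟩), h'⟩, rfl⟩
  choose f hf using step
  let s (n : ℕ) : T n := Nat.rec ⟨(D0, ⟨D1, h1⟩), h1'⟩ f n
  refine ⟨fun n => (s n).1.1.1, fun n => (s n).1.1.2, fun n => ?_⟩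
  have h : (s (n + 1)).1.1 = (s n).1.2 := hf n (s n)
  rw [h]
  exact (s n).2

variable {P} (L : P.Lift)

namespace Lift

/-- The prolongation sequence of the fibres in positive degrees. -/
noncomputable def seq : PSeq.{v} δ where
  obj n := P.Quo (n + 1)
  hom n := L.hom (n + 1)
  comm n := by
    have h (k) : (DW.fstHom δ _).comp (L.hom k) = P.quoIncl k := AlgHom.ext (L.fst k)
    rw [h, h]
    exact AlgHom.ext fun z => (L.lateral (n + 1)).quoIncl z

theorem seq_incl (n : ℕ) (z : P.Quo (n + 1)) : L.seq.incl n z = P.quoIncl (n + 1) z :=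
  L.fst (n + 1) z

/-- The lateral formula expresses `δ² y` through `Δ(δ y)` and values of `K` on elements already
generated, so exchanging `δ` for `Δ` loses no generators. -/
theorem seq_gen (hS : IsCanonical.{v, w} S) (n : ℕ) :
    Algebra.adjoin R (Set.range (L.seq.incl n) ∪ Set.range (L.seq.der n)) = ⊤ := by
  set A : Subalgebra R (P.Quo (n + 2)) :=
    Algebra.adjoin R (Set.range (L.seq.incl n) ∪ Set.range (L.seq.der n)) with hA
  have hi (z) : P.quoIncl (n + 1) z ∈ A := Algebra.subset_adjoin (Or.inl ⟨z, L.seq_incl n z⟩)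
  have hd (z) : (L.hom (n + 1) z).snd ∈ A := Algebra.subset_adjoin (Or.inr ⟨z, rfl⟩)
  have hk {a b : P.Quo (n + 2)} (ha : a ∈ A) (hb : b ∈ A) : kSum π R a b ∈ A := by
    have := kSum_map_algHom π R A.val ⟨a, ha⟩ ⟨b, hb⟩
    exact this ▸ Subtype.property _
  have hder (y : S.obj (n + 1)) : P.proj (n + 2) (S.der (n + 1) y) ∈ A := by
    -- The `y` for which both `u y` and `δ y` land in `A` form a subalgebra, the preimage of
    -- `W₁(A)`. It is therefore enough to test generators.
    have key : ⊤ ≤ (DW.map (δ := δ) A.val).range.comap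
        ((DW.map (P.proj (n + 2))).comp (S.hom (n + 1))) := by
      rw [← hS.gen n, Algebra.adjoin_le_iff]
      have hmem (y) (h : P.proj (n + 2) (S.der (n + 1) y) ∈ A) :
          y ∈ (DW.map (δ := δ) A.val).range.comap
            ((DW.map (P.proj (n + 2))).comp (S.hom (n + 1))) :=
        ⟨DW.mk ⟨_, hi (P.proj (n + 1) y)⟩ ⟨_, h⟩, rfl⟩
      rintro _ (⟨y, rfl⟩ | ⟨y, rfl⟩)
      · refine hmem _ ?_
        rw [der_incl]
        exact hi (P.proj (n + 1) (S.der n y))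
      · refine hmem _ ?_
        have h := (L.lateral n).snd (L.fst n) y
        rw [eq_sub_iff_add_eq, ← sub_eq_iff_eq_add] at h
        rw [← h]
        exact sub_mem (add_mem (hd _) (hk (hi (P.proj (n + 1) _)) (hi _)))
          (hk (hi (P.proj (n + 1) _)) (hi (P.proj (n + 1) _)))
    obtain ⟨x, hx⟩ := key (Algebra.mem_top (x := y))
    have h2 : P.proj (n + 2) (S.der (n + 1) y) = (x.snd : P.Quo (n + 2)) :=
      (congrArg DW.snd hx).symm
    rw [h2]
    exact Subtype.property _
  have key : ⊤ ≤ A.comap (P.proj (n + 2)) := by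
    rw [← hS.gen (n + 1), Algebra.adjoin_le_iff]
    rintro _ (⟨y, rfl⟩ | ⟨y, rfl⟩)
    · exact hi (P.proj (n + 1) y)
    · exact hder y
  refine top_le_iff.1 fun z _ => ?_
  obtain ⟨y, rfl⟩ := P.proj_surjective (n + 2) z
  exact key (Algebra.mem_top (x := y))

/-- `Compat` is vacuous at the first index, but there the preceding fibre is `R` and `R`-linearity
gives the same equation. -/
theorem eq_map_of_compat {n : ℕ} {C : Type*} [CommRing C] [Algebra R C]
    {E : P.Quo (n + 1) →ₐ[R] DW δ C} (hE : L.seq.Compat n E) (z : P.Quo n) :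
    E (P.quoIncl n z) = DW.map ((DW.fstHom δ C).comp E) (L.hom n z) := by
  cases n with
  | zero =>
    obtain ⟨r, rfl⟩ := P.exists_eq_algebraMap z
    simp only [AlgHom.commutes]
  | succ n =>
    rw [← L.seq_incl]
    exact DFunLike.congr_fun hE z

/-- A prolongation of the fibre is pulled back to the given sequence and the exchange is undone. The
universal property of the given sequence, used twice, then yields a map two terms further on, which
descends to the fibre. -/
theorem seq_isCanonical (hS : IsCanonical.{v, w} S) : IsCanonical.{v, w} L.seq where
  gen := L.seq_gen hS
  ex n C _ _ E' hE := by
    let E : P.Quo (n + 1) →ₐ[R] DW δ C := E'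
    let r : P.Quo (n + 1) →ₐ[R] C := (DW.fstHom δ C).comp E
    have hEr (z) : (E z).fst = r z := rfl
    have hc (z) : E (P.quoIncl n z) = DW.map r (L.hom n z) := L.eq_map_of_compat hE z
    let f : S.obj n →ₐ[R] DW δ (DW δ C) :=
      (DW.map (E.comp (P.proj (n + 1)))).comp (S.hom n)
    let ω : S.obj n →ₐ[R] DW δ C := (DW.map (r.comp (P.proj (n + 1)))).comp (S.hom n)
    -- The component `(y, Δ y)` is exchanged back for `(y, δ y)`, so `Z` looks like the twofold
    -- prolongation of a map on the original sequence.
    let Z : S.obj n →ₐ[R] DW δ (DW δ C) := DW.replaceFstHom f ω fun _ => rfl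
    have hZ1 (y) : (Z y).fst = DW.mk (r (P.proj (n + 1) (S.incl n y)))
      (r (P.proj (n + 1) (S.der n y))) := rfl
    have hZ2 (y) : (Z y).snd = DW.mk (r (P.proj (n + 1) (S.der n y)))
      ((E (P.proj (n + 1) (S.der n y))).snd + kSum π R (r (P.proj (n + 1) (S.incl n y)))
          (E (P.proj (n + 1) (S.incl n y))).snd -
        kSum π R (r (P.proj (n + 1) (S.incl n y))) (r (P.proj (n + 1) (S.der n y)))) := rfl
    have hZ : S.Compat n Z := by
      clear_value Z
      cases n with
      | zero => trivial
      | succ n =>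
        refine AlgHom.ext fun y => ?_
        change Z (S.incl n y) = DW.mk (Z (S.incl n y)).fst (Z (S.der n y)).fst
        refine DW.ext rfl ?_
        rw [DW.snd_mk, hZ1, hZ2]
        refine DW.ext ?_ ?_
        · simp only [DW.fst_mk, der_incl]
        · simp only [DW.snd_mk, der_incl]
          rw [← quoIncl_proj, ← quoIncl_proj, ← quoIncl_proj, hc, hc, DW.snd_map, DW.snd_map,
            (L.lateral n).snd (L.fst n), (L.lateral n).quoIncl]
          simp only [map_sub, map_add, kSum_map_algHom, quoIncl_proj, DW.snd_map]
          ring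
    -- `Γ` is to be `y ↦ (G (u y), G (δ y))` for the desired `G`; the second use of the universal
    -- property extracts `G`.
    obtain ⟨Γ, hΓ⟩ := hS.ex n _ Z hZ
    have hΓ1 (y) : Γ (S.incl n y) = (Z y).fst := congrArg DW.fst (DFunLike.congr_fun hΓ y)
    have hΓ2 (y) : Γ (S.der n y) = (Z y).snd := congrArg DW.snd (DFunLike.congr_fun hΓ y)
    have hΓ3 : (DW.fstHom δ C).comp Γ = r.comp (P.proj (n + 1)) := by
      refine hS.hom_ext (fun y => ?_) fun y => ?_
      · have h : (Γ (S.incl n y)).fst = r (P.proj (n + 1) (S.incl n y)) := by rw [hΓ1, hZ1]; rfl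
        exact h
      · have h : (Γ (S.der n y)).fst = r (P.proj (n + 1) (S.der n y)) := by rw [hΓ2, hZ2]; rfl
        exact h
    have hΓ4 : S.Compat (n + 1) Γ := by
      refine AlgHom.ext fun y => ?_
      rw [hΓ3]
      exact hΓ1 y
    obtain ⟨G, hG⟩ := hS.ex (n + 1) _ Γ hΓ4
    have hG1 (y) : G (S.incl (n + 1) y) = r (P.proj (n + 1) y) :=
      (congrArg DW.fst (DFunLike.congr_fun hG y)).trans (DFunLike.congr_fun hΓ3 y)
    have hG2 (y) : G (S.der (n + 1) y) = (Γ y).snd :=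
      congrArg DW.snd (DFunLike.congr_fun hG y)
    have hker : P.ideal (n + 2) ≤ RingHom.ker G := by
      rw [ideal, Ideal.map_le_iff_le_comap]
      intro y hy
      change G (S.incl (n + 1) y) = 0
      have : P.proj (n + 1) y = 0 := Ideal.Quotient.eq_zero_iff_mem.2 hy
      rw [hG1, this, map_zero]
    let g : P.Quo (n + 2) →ₐ[R] C := Ideal.Quotient.liftₐ (P.ideal (n + 2)) G hker
    have hg (y) : g (P.proj (n + 2) y) = G y := rfl
    have hgr : g.comp (P.quoIncl (n + 1)) = r := Ideal.Quotient.algHom_ext _ (AlgHom.ext hG1)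
    have hgr' (z) : g (P.quoIncl (n + 1) z) = r z := DFunLike.congr_fun hgr z
    refine ⟨g, Ideal.Quotient.algHom_ext _ ?_⟩
    change ((DW.map g).comp (L.hom (n + 1))).comp (P.proj (n + 1)) = E.comp (P.proj (n + 1))
    refine hS.hom_ext (fun y => ?_) fun y => ?_
    · change DW.map g (L.hom (n + 1) (P.quoIncl n (P.proj n y))) = E (P.quoIncl n (P.proj n y))
      rw [(L.lateral n).quoIncl, DW.map_map, hgr, hc]
    · change DW.map g (L.hom (n + 1) (P.proj (n + 1) (S.der n y))) =
        E (P.proj (n + 1) (S.der n y))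
      refine DW.ext ?_ ?_
      · rw [DW.fst_map, L.fst, hgr', hEr]
      · have h3 : (E (P.proj (n + 1) (S.incl n y))).snd = r (L.hom n (P.proj n y)).snd :=
          congrArg DW.snd (hc (P.proj n y))
        rw [DW.snd_map, (L.lateral n).snd (L.fst n)]
        simp only [map_sub, map_add, kSum_map_algHom, hgr', hg, hG1, hG2, hΓ2, hZ2, DW.snd_mk,
          h3]
        ring

/-- The Frobenius lifts of the fibres and of the given sequence. -/
theorem seq_frob (n : ℕ) (y : S.obj n) :
    L.seq.frob n (P.proj (n + 1) (S.frob n y)) =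
      P.proj (n + 2) (S.frob (n + 1) (S.frob n y)) := by
  let f : P.Quo (n + 1) →+* P.Quo (n + 2) := L.seq.frob n
  have hf (z) : f z = P.quoIncl (n + 1) z ^ resCard π +
      piIn π R (P.Quo (n + 2)) * (L.hom (n + 1) z).snd := by
    rw [← L.fst]
    rfl
  change f _ = _
  have h1 : f (P.proj (n + 1) (S.incl n y)) =
      P.proj (n + 2) (S.incl (n + 1) (S.incl n y)) ^ resCard π +
        piIn π R _ * P.quoIncl (n + 1) (L.hom n (P.proj n y)).snd := by
    rw [hf, quoIncl_proj]
    congr 2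
    exact congrArg DW.snd ((L.lateral n).quoIncl (P.proj n y))
  have h2 : f (P.proj (n + 1) (S.der n y)) =
      P.proj (n + 2) (S.incl (n + 1) (S.der n y)) ^ resCard π +
        piIn π R _ * (L.hom (n + 1) (P.proj (n + 1) (S.der n y))).snd := by
    rw [hf, quoIncl_proj]
  have h3 : f (piIn π R (P.Quo (n + 1))) = piIn π R (P.Quo (n + 2)) := by
    change DW.ghost δ _ (L.hom (n + 1) (algebraMap R _ _)) = _
    rw [AlgHom.commutes, DW.ghost_algebraMap]
    rfl
  have h4 (k) (z : S.obj (k + 1)) : S.frob (k + 1) z = S.incl (k + 1) z ^ resCard π +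
    piIn π R _ * S.der (k + 1) z := rfl
  have h5 : P.proj (n + 1) (piIn π R (S.obj (n + 1))) = piIn π R (P.Quo (n + 1)) :=
    (P.proj (n + 1)).commutes _
  have h6 : P.proj (n + 2) (piIn π R (S.obj (n + 2))) = piIn π R (P.Quo (n + 2)) :=
    (P.proj (n + 2)).commutes _
  have h7 : S.frob (n + 1) (piIn π R (S.obj (n + 1))) = piIn π R (S.obj (n + 2)) := by
    change DW.ghost δ _ (S.hom (n + 1) (algebraMap R _ _)) = _
    rw [AlgHom.commutes, DW.ghost_algebraMap]
    rfl
  have h8 := (L.lateral n).snd (L.fst n) y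
  have h9 := pi_sq_mul_kSum π R (P.proj (n + 2) (S.incl (n + 1) (S.incl n y)))
    (P.proj (n + 2) (S.incl (n + 1) (S.der n y)))
  have h10 := pi_sq_mul_kSum π R (P.proj (n + 2) (S.incl (n + 1) (S.incl n y)))
    (P.quoIncl (n + 1) (L.hom n (P.proj n y)).snd)
  rw [frob_apply, _root_.map_add, map_pow, _root_.map_mul, h5]
  rw [RingHom.map_add, RingHom.map_pow, RingHom.map_mul, h1, h2, h3]
  rw [RingHom.map_add, RingHom.map_pow, RingHom.map_mul, h7, h4, h4]
  simp only [map_add, map_mul, map_pow, h6, der_incl, h8]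
  -- The terms `π ^ 2 K` in `Δ(δ y)` are exactly the difference between the `q`-th powers of `y ^ q
  -- + π δ y` and `y ^ q + π Δ y`.
  linear_combination h9 - h10

/-- The induced point of the sequence of fibres. -/
noncomputable def point (hS : IsCanonical.{v, w} S) : L.seq.Point where
  toHom n := P.quoHom (n + 1)
  incl n z := by
    exact (congrArg (P.quoHom (n + 2)) (L.fst (n + 1) z)).trans (P.quoHom_quoIncl (n + 1) z)
  der n z := by
    have key (k) : (DW.map (P.quoHom (k + 1))).comp (L.hom k) =
        (Algebra.ofId R (DW δ R)).comp (P.quoHom k) := by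
      induction k with
      | zero =>
        refine AlgHom.ext fun z => ?_
        obtain ⟨r, rfl⟩ := P.exists_eq_algebraMap z
        simp only [AlgHom.commutes]
      | succ k ih =>
        have ih' (z) : P.quoHom (k + 1) (L.hom k z).snd = δ.toFun (P.quoHom k z) :=
          congrArg DW.snd (DFunLike.congr_fun ih z)
        refine Ideal.Quotient.algHom_ext _ (hS.hom_ext (fun y => ?_) fun y => ?_)
        · change DW.map _ (L.hom (k + 1) (P.quoIncl k (P.proj k y))) =
            algebraMap R _ (P.toHom (k + 1) (S.incl k y))
          rw [(L.lateral k).quoIncl]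
          refine DW.ext ?_ ?_
          · simp only [DW.fst_map, quoHom_quoIncl, L.fst, quoHom_proj, P.incl]
            rfl
          · simp only [DW.snd_map, quoHom_quoIncl, ih', quoHom_proj, P.incl]
            rfl
        · change DW.map _ (L.hom (k + 1) (P.proj (k + 1) (S.der k y))) =
            algebraMap R _ (P.toHom (k + 1) (S.der k y))
          refine DW.ext ?_ ?_
          · simp only [DW.fst_map, quoHom_quoIncl, L.fst, quoHom_proj]
            rfl
          · simp only [DW.snd_map, (L.lateral k).snd (L.fst k), map_sub, map_add,
              kSum_map_algHom, quoHom_quoIncl, ih', quoHom_proj, P.incl, P.der]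
            -- At the point, `δ y` and `Δ y` both take the value `δ (P y)`, so the two values of `K`
            -- cancel.
            rw [add_sub_cancel_right]
            rfl
    exact congrArg DW.snd (DFunLike.congr_fun (key (n + 1)) z)

end Lift

end Point

end PSeq

end Derived

/-! ### Uniqueness of canonical sequences -/

section Comparison

universe v w

variable {O : Type*} [CommRing O] [IsDomain O] {π : O} [Fact (Prime π)]
  [Finite (O ⧸ Ideal.span {π})]
  {R : Type*} [CommRing R] [Algebra O R] {δ : PiDerivation π R}

namespace PSeq

/-- A morphism of prolongation sequences. -/
structure Mor (S : PSeq.{v} δ) (T : PSeq.{w} δ) where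
  /-- The homomorphisms between the terms. -/
  toHom (n : ℕ) : S.obj n →ₐ[R] T.obj n
  comm (n : ℕ) (y : S.obj n) :
    DW.map (toHom (n + 1)) (S.hom n y) = T.hom n (toHom n y)

variable {S : PSeq.{v} δ} {T : PSeq.{w} δ}

theorem Mor.incl (f : S.Mor T) (n : ℕ) (y : S.obj n) :
    f.toHom (n + 1) (S.incl n y) = T.incl n (f.toHom n y) := congrArg DW.fst (f.comm n y)

theorem Mor.der (f : S.Mor T) (n : ℕ) (y : S.obj n) :
    f.toHom (n + 1) (S.der n y) = T.der n (f.toHom n y) := congrArg DW.snd (f.comm n y)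

/-- Composition of morphisms. -/
noncomputable def Mor.comp (f : S.Mor T) (g : T.Mor S) : S.Mor S where
  toHom n := (g.toHom n).comp (f.toHom n)
  comm n y := by rw [← DW.map_map, f.comm, g.comm]; rfl

theorem Mor.toHom_eq (hS : IsCanonical.{v, w} S) {U : PSeq δ} (f g : S.Mor U)
    (h : f.toHom 0 = g.toHom 0) (n : ℕ) : f.toHom n = g.toHom n := by
  induction n with
  | zero => exact h
  | succ n ih =>
    refine hS.hom_ext (fun y => ?_) fun y => ?_
    · rw [f.incl, g.incl, ih]
    · rw [f.der, g.der, ih]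

theorem IsCanonical.exists_mor (hS : IsCanonical.{v, w} S) (f₀ : S.obj 0 →ₐ[R] T.obj 0) :
    ∃ f : S.Mor T, f.toHom 0 = f₀ := by
  let H (n : ℕ) := S.obj n →ₐ[R] T.obj n
  let A (n : ℕ) := {p : H n × H (n + 1) //
    ∀ y, DW.map p.2 (S.hom n y) = T.hom n (p.1 y)}
  obtain ⟨f₁, h₁⟩ := hS.ex 0 _ ((T.hom 0).comp f₀) trivial
  have step (n : ℕ) (t : A n) : ∃ t' : A (n + 1), t'.1.1 = t.1.2 := by
    obtain ⟨⟨f, g⟩, h⟩ := t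
    dsimp only at h
    have hc : S.Compat (n + 1) ((T.hom (n + 1)).comp g) := by
      refine AlgHom.ext fun y => ?_
      have h1 : g (S.incl n y) = T.incl n (f y) := congrArg DW.fst (h y)
      change T.hom (n + 1) (g (S.incl n y)) =
        DW.map ((T.incl (n + 1)).comp g) (S.hom n y)
      rw [h1, ← DW.map_map, h, T.hom_incl]
    obtain ⟨g', h'⟩ := hS.ex (n + 1) _ _ hc
    exact ⟨⟨(g, g'), fun y => DFunLike.congr_fun h' y⟩, rfl⟩
  choose F hF using step
  let s (n : ℕ) : A n := Nat.rec ⟨(f₀, f₁), fun y => DFunLike.congr_fun h₁ y⟩ F n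
  refine ⟨⟨fun n => (s n).1.1, fun n y => ?_⟩, rfl⟩
  have h : (s (n + 1)).1.1 = (s n).1.2 := hF n (s n)
  rw [h]
  exact (s n).2 y

/-- Canonical sequences with isomorphic terms of index zero are isomorphic. -/
theorem IsCanonical.exists_equiv (hS : IsCanonical.{v, w} S) (hT : IsCanonical.{w, v} T)
    (e₀ : S.obj 0 ≃ₐ[R] T.obj 0) :
    ∃ e : ∀ n, S.obj n ≃ₐ[R] T.obj n, e 0 = e₀ ∧
      (∀ n y, e (n + 1) (S.incl n y) = T.incl n (e n y)) ∧
      ∀ n y, e (n + 1) (S.der n y) = T.der n (e n y) := by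
  obtain ⟨f, hf⟩ := hS.exists_mor (T := T) (e₀ : S.obj 0 →ₐ[R] T.obj 0)
  obtain ⟨g, hg⟩ := hT.exists_mor (T := S) (e₀.symm : T.obj 0 →ₐ[R] S.obj 0)
  have h1 (n) : (f.toHom n).comp (g.toHom n) = AlgHom.id R _ := by
    refine (g.comp f).toHom_eq hT ⟨fun n => AlgHom.id R _, fun _ _ => rfl⟩ ?_ n
    refine AlgHom.ext fun y => ?_
    change f.toHom 0 (g.toHom 0 y) = y
    rw [hf, hg]
    exact e₀.apply_symm_apply y
  have h2 (n) : (g.toHom n).comp (f.toHom n) = AlgHom.id R _ := by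
    refine (f.comp g).toHom_eq hS ⟨fun n => AlgHom.id R _, fun _ _ => rfl⟩ ?_ n
    refine AlgHom.ext fun y => ?_
    change g.toHom 0 (f.toHom 0 y) = y
    rw [hf, hg]
    exact e₀.symm_apply_apply y
  exact ⟨fun n => AlgEquiv.ofAlgHom (f.toHom n) (g.toHom n) (h1 n) (h2 n),
    AlgEquiv.ext fun y => DFunLike.congr_fun hf y, f.incl, f.der⟩

variable (S) in
/-- The transition maps from the term of index zero. -/
noncomputable def inclZero : ∀ n, S.obj 0 →ₐ[R] S.obj n
  | 0 => AlgHom.id R _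
  | n + 1 => (S.incl n).comp (inclZero n)

theorem Point.proj_inclZero (P : S.Point) (n : ℕ) (y : S.obj 0) :
    P.proj n (S.inclZero n y) = algebraMap R _ (P.toHom 0 y) := by
  induction n with
  | zero => exact P.proj_zero_eq y
  | succ n ih =>
    refine (congrArg (P.quoIncl n) ih).trans ?_
    rw [AlgHom.commutes]

/-- The recursive definition of the ideal suits one-step arguments. This closed form reduces a
vanishing check to elements of index zero. -/
theorem Point.ideal_eq (P : S.Point) (n : ℕ) :
    P.ideal n = (RingHom.ker (P.toHom 0)).map (S.inclZero n) := by
  induction n with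
  | zero => exact (Ideal.map_id _).symm
  | succ n ih =>
    rw [ideal, ih]
    exact Ideal.map_map (S.inclZero n).toRingHom (S.incl n).toRingHom

/-- A homomorphism to `W₁(C)` is a prolongation. -/
noncomputable def prolongationOfHom {B C : Type*} [CommRing B] [Algebra R B] [CommRing C]
    [Algebra R C] (u : B →ₐ[R] C) (H : B →ₐ[R] DW δ C) (h : ∀ y, (H y).fst = u y) :
    Prolongation δ u where
  toFun y := (H y).snd
  map_base r := by rw [H.commutes]; rfl
  map_add x y := by rw [_root_.map_add, DW.snd_add, h, h]
  map_mul x y := by rw [_root_.map_mul, DW.snd_mul, h, h]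

end PSeq

end Comparison

/-! ### The tensor product `B ⊗_J R` as a quotient of `B` -/

section Fibres

variable {R : Type*} [CommRing R]
  {J B : Type*} [CommRing J] [Algebra R J] [CommRing B] [Algebra R B]
  (u : J →ₐ[R] B) (p : J →ₐ[R] R)

theorem Fibre.incl_apply (j : J) :
    Fibre.incl u p (u j) = algebraMap R (Fibre u p) (p j) := by
  let := u.toRingHom.toAlgebra
  let := p.toRingHom.toAlgebra
  change (u j) ⊗ₜ[J] (1 : R) = (1 : B) ⊗ₜ[J] (p j)
  have h1 : u j = j • (1 : B) := by rw [Algebra.smul_def, mul_one]; rfl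
  have h2 : p j = j • (1 : R) := by rw [Algebra.smul_def, mul_one]; rfl
  rw [h1, h2, TensorProduct.smul_tmul]

theorem Fibre.incl_surjective : Function.Surjective (Fibre.incl u p) := by
  let := u.toRingHom.toAlgebra
  let := p.toRingHom.toAlgebra
  intro z
  change TensorProduct J B R at z
  induction z using TensorProduct.induction_on with
  | zero => exact ⟨0, _root_.map_zero _⟩
  | tmul b r =>
    refine ⟨b * algebraMap R B r, ?_⟩
    rw [_root_.map_mul, AlgHom.commutes]
    change (b ⊗ₜ[J] (1 : R)) * ((1 : B) ⊗ₜ[J] r) = b ⊗ₜ[J] r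
    rw [Algebra.TensorProduct.tmul_mul_tmul, mul_one, one_mul]
  | add x y hx hy =>
    obtain ⟨a, ha⟩ := hx
    obtain ⟨b, hb⟩ := hy
    exact ⟨a + b, by rw [_root_.map_add, ha, hb]; rfl⟩

theorem Fibre.exists_lift {C : Type*} [CommRing C] [Algebra R C] (g : B →ₐ[R] C)
    (hg : ∀ j, g (u j) = algebraMap R C (p j)) :
    ∃ g' : Fibre u p →ₐ[R] C, ∀ b, g' (Fibre.incl u p b) = g b := by
  let := u.toRingHom.toAlgebra
  let := p.toRingHom.toAlgebra
  let := (g.comp u).toRingHom.toAlgebra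
  let f1 : B →ₐ[J] C := { g.toRingHom with commutes' := fun _ => rfl }
  let f2 : R →ₐ[J] C := { algebraMap R C with commutes' := fun j => (hg j).symm }
  let f := Algebra.TensorProduct.lift f1 f2 fun _ _ => Commute.all _ _
  refine ⟨{ f.toRingHom with commutes' := fun r => ?_ }, fun b => ?_⟩
  · change f ((1 : B) ⊗ₜ[J] r) = algebraMap R C r
    rw [Algebra.TensorProduct.lift_tmul, _root_.map_one, one_mul]
    rfl
  · change f (b ⊗ₜ[J] (1 : R)) = g b
    rw [Algebra.TensorProduct.lift_tmul, _root_.map_one, mul_one]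
    rfl

theorem Fibre.map_incl {B' : Type*} [CommRing B'] [Algebra R B'] {u : J →ₐ[R] B}
    {u' : J →ₐ[R] B'} (p : J →ₐ[R] R) (v : B →ₐ[R] B') (h : v.comp u = u') (b : B) :
    Fibre.map p v h (Fibre.incl u p b) = Fibre.incl u' p (v b) := by
  let := u.toRingHom.toAlgebra
  let := u'.toRingHom.toAlgebra
  let := p.toRingHom.toAlgebra
  change Algebra.TensorProduct.map _ _ (b ⊗ₜ[J] (1 : R)) = (v b) ⊗ₜ[J] (1 : R)
  rw [Algebra.TensorProduct.map_tmul]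
  rfl

end Fibres

/-! ### Iterating the fibre construction over the jet algebras -/

section Tower

universe a b c w

variable {O : Type a} [CommRing O] [IsDomain O] {π : O} [Fact (Prime π)]
  [Finite (O ⧸ Ideal.span {π})]
  {R : Type b} [CommRing R] [Algebra O R] (δ : PiDerivation π R) {σ : Type c}
  (I : Ideal (MvPolynomial σ R)) (P : (MvPolynomial σ R ⧸ I) →ₐ[R] R)

/-- The canonical map `A → J_0 A` is an isomorphism. -/
theorem jetBase_bijective : Function.Bijective (jetBase δ I) := by
  let G : JetPoly R σ 0 →ₐ[R] MvPolynomial σ R ⧸ I :=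
    aeval fun v => Ideal.Quotient.mk I (X v.1)
  have hG (f : MvPolynomial σ R) :
      G (rename (fun s => (s, (0 : Fin 1))) f) = Ideal.Quotient.mk I f := by
    rw [aeval_rename]
    have : (aeval fun s => Ideal.Quotient.mk I (X s)) = Ideal.Quotient.mkₐ R I :=
      MvPolynomial.algHom_ext fun s => aeval_X _ s
    exact DFunLike.congr_fun this f
  have hker : jetIdeal δ I 0 ≤ RingHom.ker G := by
    rw [jetIdeal, Ideal.span_le]
    rintro _ ⟨i, hi, f, hf, rfl⟩
    obtain rfl : i = 0 := by omega
    rw [polyIncl_self, polyIter]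
    exact (hG f).trans (Ideal.Quotient.eq_zero_iff_mem.2 hf)
  refine Function.bijective_iff_has_inverse.2
    ⟨Ideal.Quotient.liftₐ (jetIdeal δ I 0) G hker, fun y => ?_, fun y => ?_⟩
  · obtain ⟨f, rfl⟩ := Ideal.Quotient.mk_surjective y
    exact hG f
  · have : (jetBase δ I).comp (Ideal.Quotient.liftₐ (jetIdeal δ I 0) G hker) =
        AlgHom.id R _ := by
      refine Ideal.Quotient.algHom_ext _ (MvPolynomial.algHom_ext fun ⟨s, j⟩ => ?_)
      obtain rfl : j = (0 : Fin (0 + 1)) := Fin.ext (by omega)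
      change jetBase δ I (G (X (s, 0))) = Ideal.Quotient.mk _ (X (s, 0))
      have : G (X (s, 0)) = Ideal.Quotient.mk I (X s) := aeval_X _ _
      rw [this]
      exact congrArg (Ideal.Quotient.mk (jetIdeal δ I 0)) (rename_X _ s)
    exact DFunLike.congr_fun this y

theorem jetPoint_incl {k l : ℕ} (h : k ≤ l) (y : JetAlg δ I k) :
    jetPoint δ I P l (jetIncl δ I h y) = jetPoint δ I P k y := by
  obtain ⟨f, rfl⟩ := Ideal.Quotient.mk_surjective y
  exact polyPoint_incl δ (fun s => P (Ideal.Quotient.mk I (X s))) h f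

/-- The points `P_n` of the jet algebras. -/
noncomputable def jetSeqPoint : (jetSeq δ I).Point where
  toHom := jetPoint δ I P
  incl n y := (congrArg (jetPoint δ I P (n + 1)) (jetSeq_incl δ I n y)).trans
    (jetPoint_incl δ I P n.le_succ y)
  der n y := by
    obtain ⟨f, rfl⟩ := Ideal.Quotient.mk_surjective y
    exact polyPoint_delta δ (fun s => P (Ideal.Quotient.mk I (X s))) n f

/-- A canonical prolongation sequence whose terms are the fibres over `P_{k-1}` (for `k ≥ 1`) of
the jet algebras, shifted by `k`, and whose Frobenius lift is lateral. -/
structure Tower (k : ℕ) where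
  /-- The prolongation sequence. -/
  seq : PSeq.{max b c} δ
  can : PSeq.IsCanonical.{max b c, max b c} seq
  -- `can` feeds the next step of the construction. The second copy allows comparison with jet
  -- algebras of a presentation in another universe.
  can' : PSeq.IsCanonical.{max b c, w} seq
  /-- The point of the sequence induced by `P`. -/
  point : seq.Point
  /-- The projections. -/
  pr (n l : ℕ) (h : l ≤ n + k) : JetAlg δ I l →ₐ[R] seq.obj n
  pr_jetIncl (n l l' : ℕ) (h : l ≤ l') (h' : l' ≤ n + k) (y : JetAlg δ I l) :
    pr n l' h' (jetIncl δ I h y) = pr n l (h.trans h') y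
  incl_pr (n l : ℕ) (h : l ≤ n + k) (h' : l ≤ n + 1 + k) (y : JetAlg δ I l) :
    seq.incl n (pr n l h y) = pr (n + 1) l h' y
  -- A propositional equality in place of the index `n + k` itself lets `m + (n + 1)` and `n + (m +
  -- 1)` both serve without transport.
  surj (n l : ℕ) (h : l = n + k) : Function.Surjective (pr n l h.le)
  -- With `surj` and `pr_eq` this characterizes the term as the fibre over `P_{k-1}`. Quantifying
  -- over `j < k` includes `k = 0`, where there is no condition.
  lift (n l : ℕ) (h : l = n + k) (C : Type max b c) [CommRing C] [Algebra R C]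
    (g : JetAlg δ I l →ₐ[R] C)
    (hg : ∀ (j : ℕ) (hj : j < k) (y : JetAlg δ I j),
      g (jetIncl δ I (by omega) y) = algebraMap R C (jetPoint δ I P j y)) :
    ∃ g' : seq.obj n →ₐ[R] C, ∀ y, g' (pr n l h.le y) = g y
  point_pr (n l : ℕ) (h : l ≤ n + k) (y : JetAlg δ I l) :
    point.toHom n (pr n l h y) = jetPoint δ I P l y
  pr_eq (n j : ℕ) (h : j < k) (y : JetAlg δ I j) :
    pr n j (by omega) y = algebraMap R _ (jetPoint δ I P j y)
  lateral (n l j : ℕ) (hj : k ≤ j) (h : l + j ≤ n + k) (h' : l + (j + 1) ≤ n + 1 + k)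
    (y : JetAlg δ I l) : seq.frob n (pr n (l + j) h (jetFrobIter δ I l y j)) =
      pr (n + 1) (l + (j + 1)) h' (jetFrobIter δ I l y (j + 1))

variable {δ I P} in
theorem Tower.inclZero_pr {k : ℕ} (T : Tower.{a, b, c, w} δ I P k) (n l : ℕ) (h : l ≤ 0 + k)
    (y : JetAlg δ I l) : T.seq.inclZero n (T.pr 0 l h y) = T.pr n l (by omega) y := by
  induction n with
  | zero => rfl
  | succ n ih => exact (congrArg (T.seq.incl n) ih).trans (T.incl_pr n l _ _ y)

theorem frob_jetIncl {k l : ℕ} (h : k ≤ l) (y : JetAlg δ I k) :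
    frob π R (jetIncl δ I l.le_succ) (jetDelta δ I l) (jetIncl δ I h y) =
      jetIncl δ I (Nat.succ_le_succ h)
        (frob π R (jetIncl δ I k.le_succ) (jetDelta δ I k) y) := by
  simp only [frob, map_add, map_mul, map_pow, jetIncl_trans, jetDelta_incl, piIn,
    AlgHom.commutes]

theorem nonempty_tower_zero : Nonempty (Tower.{a, b, c, w} δ I P 0) := ⟨{
  seq := jetSeq δ I
  can := jetSeq_isCanonical δ I
  can' := jetSeq_isCanonical δ I
  point := jetSeqPoint δ I P
  pr := fun n l h => jetIncl δ I h
  pr_jetIncl := fun n l l' h h' y => jetIncl_trans δ I h h' y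
  incl_pr := fun n l h h' y => (jetSeq_incl δ I n _).trans (jetIncl_trans δ I h n.le_succ y)
  surj := fun n l h y =>
    ⟨jetIncl δ I h.ge y, (jetIncl_trans δ I _ _ y).trans (jetIncl_self δ I y)⟩
  lift := fun n l h C _ _ g _ =>
    ⟨g.comp (jetIncl δ I h.ge), fun y =>
      congrArg g ((jetIncl_trans δ I _ _ y).trans (jetIncl_self δ I y))⟩
  point_pr := fun n l h y => jetPoint_incl δ I P h y
  pr_eq := fun n j h => absurd h (Nat.not_lt_zero j)
  lateral := fun n l j _ h h' y => by
    refine (congrArg (fun t : JetAlg δ I (n + 1) => t ^ resCard π + piIn π R _ *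
      jetDelta δ I n (jetIncl δ I h (jetFrobIter δ I l y j))) (jetSeq_incl δ I n _)).trans ?_
    exact frob_jetIncl δ I h _ }⟩

variable {δ I P} in
-- The new sequence consists of the fibres over the term of index zero, from index one on; this
-- shift is the extra `1` in `k + 1`.
theorem Tower.nonempty_succ {k : ℕ} (T : Tower.{a, b, c, w} δ I P k) :
    Nonempty (Tower.{a, b, c, w} δ I P (k + 1)) := by
  obtain ⟨L⟩ := T.point.nonempty_lift T.can
  exact ⟨{
    seq := L.seq
    can := L.seq_isCanonical T.can
    can' := L.seq_isCanonical T.can'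
    point := L.point T.can
    pr := fun n l h => (T.point.proj (n + 1)).comp (T.pr (n + 1) l (by omega))
    pr_jetIncl := fun n l l' h h' y =>
      congrArg (T.point.proj (n + 1)) (T.pr_jetIncl (n + 1) l l' h _ y)
    incl_pr := fun n l h h' y => by
      refine (L.seq_incl n _).trans ?_
      exact congrArg (T.point.proj (n + 2)) (T.incl_pr (n + 1) l _ _ y)
    surj := fun n l h =>
      (T.point.proj_surjective (n + 1)).comp (T.surj (n + 1) l (by omega))
    lift := fun n l h C _ _ g hg => by
      obtain ⟨g', hg'⟩ := T.lift (n + 1) l (by omega) C g fun j hj y => hg j (by omega) y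
      have hker : T.point.ideal (n + 1) ≤ RingHom.ker g' := by
        rw [T.point.ideal_eq, Ideal.map_le_iff_le_comap]
        intro z hz
        -- Since `J_k` surjects onto the term of index zero, the ideal to be killed is generated by
        -- images of the kernel of `P_k`.
        obtain ⟨y, rfl⟩ := T.surj 0 k (by omega) z
        change g' (T.seq.inclZero (n + 1) _) = 0
        have hz' : jetPoint δ I P k y = 0 := (T.point_pr 0 k _ y).symm.trans hz
        rw [T.inclZero_pr, ← T.pr_jetIncl (n + 1) k l (by omega) (by omega), hg',
          hg k (by omega), hz', map_zero]
      exact ⟨Ideal.Quotient.liftₐ (T.point.ideal (n + 1)) g' hker, hg'⟩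
    point_pr := fun n l h y => T.point_pr (n + 1) l _ y
    pr_eq := fun n j h y => by
      change T.point.proj (n + 1) (T.pr (n + 1) j _ y) = _
      rcases Nat.lt_or_ge j k with hj | hj
      · rw [T.pr_eq (n + 1) j hj, AlgHom.commutes]
        rfl
      · obtain rfl : j = k := by omega
        rw [← T.inclZero_pr (n + 1) j (by omega), T.point.proj_inclZero, T.point_pr]
        rfl
    lateral := fun n l j hj h h' y => by
      -- `seq_frob` needs an element in the image of the previous Frobenius lift. By laterality one
      -- stage lower, the projection of `φ^(i+1) y` is such an element.
      obtain ⟨i, rfl⟩ : ∃ i, j = i + 1 := ⟨j - 1, by omega⟩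
      change L.seq.frob n (T.point.proj (n + 1) (T.pr (n + 1) _ _ _)) =
        T.point.proj (n + 2) (T.pr (n + 2) _ _ _)
      rw [← T.lateral n l i (by omega) (by omega), L.seq_frob,
        ← T.lateral (n + 1) l (i + 1) (by omega) (by omega),
        ← T.lateral n l i (by omega) (by omega)] }⟩

theorem nonempty_tower (k : ℕ) : Nonempty (Tower.{a, b, c, w} δ I P k) := by
  induction k with
  | zero => exact nonempty_tower_zero δ I P
  | succ k ih =>
    obtain ⟨T⟩ := ih
    exact T.nonempty_succ

variable {δ I P} in
/-- The terms of the tower are the kernel algebras. -/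
theorem Tower.exists_equiv {m : ℕ} (T : Tower.{a, b, c, w} δ I P (m + 1)) (n : ℕ) :
    ∃ e : T.seq.obj n ≃ₐ[R] KerAlg δ I P m (n + 1),
      ∀ y, e (T.pr n (m + (n + 1)) (by omega) y) = kerProj δ I P m (n + 1) y := by
  obtain ⟨f, hf⟩ := T.lift n (m + (n + 1)) (by omega) (KerAlg δ I P m (n + 1))
    (kerProj δ I P m (n + 1)) fun j hj y => by
      rw [← jetIncl_trans δ I (Nat.lt_succ_iff.1 hj) (Nat.le_add_right m (n + 1)), kerProj,
        Fibre.incl_apply, jetPoint_incl]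
  obtain ⟨g, hg⟩ := Fibre.exists_lift (jetIncl δ I (Nat.le_add_right m (n + 1)))
    (jetPoint δ I P m) (T.pr n (m + (n + 1)) (by omega)) fun y => by
      rw [T.pr_jetIncl, T.pr_eq n m (Nat.lt_succ_self m)]
  refine ⟨AlgEquiv.ofAlgHom f g ?_ ?_, hf⟩
  · refine AlgHom.ext fun z => ?_
    obtain ⟨y, rfl⟩ := Fibre.incl_surjective _ _ z
    exact (congrArg f (hg y)).trans (hf y)
  · refine AlgHom.ext fun z => ?_
    obtain ⟨y, rfl⟩ := T.surj n (m + (n + 1)) (by omega) z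
    exact (congrArg g (hf y)).trans (hg y)

theorem kerIncl_kerProj (m n : ℕ) (y : JetAlg δ I (m + n)) :
    kerIncl δ I P m n (kerProj δ I P m n y) =
      kerProj δ I P m (n + 1) (jetIncl δ I (Nat.le_succ (m + n)) y) :=
  Fibre.map_incl _ _ _ y

end Tower

/-! ### Transport to the kernel algebras and proof of the theorem -/

section Main

universe a b c d

variable {O : Type a} [CommRing O] [IsDomain O] {π : O} [Fact (Prime π)]
  [Finite (O ⧸ Ideal.span {π})]
  {R : Type b} [CommRing R] [Algebra O R] (δ : PiDerivation π R) {σ : Type c}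
  (I : Ideal (MvPolynomial σ R)) (P : (MvPolynomial σ R ⧸ I) →ₐ[R] R) (m : ℕ)

/-- The kernel algebras form the canonical prolongation sequence of the first one. -/
theorem exists_prolongation_kerAlg {τ : Type d} (K : Ideal (MvPolynomial τ R))
    (e : (MvPolynomial τ R ⧸ K) ≃ₐ[R] KerAlg δ I P m 1) :
    ∃ (Δ : ∀ n : ℕ, Prolongation δ (kerIncl δ I P m (n + 1)))
      (θ : ∀ n : ℕ, JetAlg δ K n ≃ₐ[R] KerAlg δ I P m (n + 1)),
      (∀ n y, (Δ (n + 1)).toFun (kerIncl δ I P m (n + 1) y) =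
        kerIncl δ I P m (n + 2) ((Δ n).toFun y)) ∧
      (∀ a, θ 0 (jetBase δ K a) = e a) ∧
      (∀ n x, θ (n + 1) (jetIncl δ K n.le_succ x) = kerIncl δ I P m (n + 1) (θ n x)) ∧
      (∀ n x, θ (n + 1) (jetDelta δ K n x) = (Δ n).toFun (θ n x)) ∧
      (∀ (n : ℕ) (h : n + (m + 1) ≤ m + (n + 1)) (h' : n + (m + 2) ≤ m + (n + 2))
        (y : JetAlg δ I n),
        frob π R (kerIncl δ I P m (n + 1)) (Δ n).toFun
          (kerProj δ I P m (n + 1) (jetIncl δ I h (jetFrobIter δ I n y (m + 1)))) =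
        kerProj δ I P m (n + 2) (jetIncl δ I h' (jetFrobIter δ I n y (m + 2)))) := by
  obtain ⟨T⟩ := nonempty_tower.{a, b, c, max b d} δ I P (m + 1)
  choose κ hκ using T.exists_equiv
  have hκ' (n l) (h : l ≤ m + (n + 1)) (h' : l ≤ n + (m + 1)) (y : JetAlg δ I l) :
      κ n (T.pr n l h' y) = kerProj δ I P m (n + 1) (jetIncl δ I h y) := by
    rw [← hκ, T.pr_jetIncl]
  have hincl (n) (z : T.seq.obj n) :
      κ (n + 1) (T.seq.incl n z) = kerIncl δ I P m (n + 1) (κ n z) := by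
    obtain ⟨y, rfl⟩ := T.surj n (m + (n + 1)) (by omega) z
    rw [T.incl_pr n _ _ (by omega), hκ, kerIncl_kerProj, hκ']
  -- The operator of the tower is carried over by the isomorphisms `κ`, which respect `u` by
  -- `hincl`.
  let H (n : ℕ) : KerAlg δ I P m (n + 1) →ₐ[R] DW δ (KerAlg δ I P m (n + 2)) :=
    ((DW.map (κ (n + 1) : T.seq.obj (n + 1) →ₐ[R] _)).comp (T.seq.hom n)).comp
      ((κ n).symm : _ →ₐ[R] T.seq.obj n)
  have hH (n) (z : KerAlg δ I P m (n + 1)) : (H n z).fst = kerIncl δ I P m (n + 1) z := by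
    exact (hincl n _).trans (congrArg _ ((κ n).apply_symm_apply z))
  let Δ (n : ℕ) : Prolongation δ (kerIncl δ I P m (n + 1)) :=
    PSeq.prolongationOfHom (kerIncl δ I P m (n + 1)) (H n) (hH n)
  have hΔ (n) (z : T.seq.obj n) : (Δ n).toFun (κ n z) = κ (n + 1) (T.seq.der n z) := by
    change κ (n + 1) (T.seq.der n ((κ n).symm (κ n z))) = _
    rw [AlgEquiv.symm_apply_apply]
  obtain ⟨E, hE0, hE1, hE2⟩ := (jetSeq_isCanonical δ K).exists_equiv T.can'
    (((AlgEquiv.ofBijective (jetBase δ K) (jetBase_bijective δ K)).symm.trans e).trans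
      (κ 0).symm)
  refine ⟨Δ, fun n => (E n).trans (κ n), fun n z => ?_, fun z => ?_, fun n x => ?_,
    fun n x => ?_, fun n h₁ h₂ y => ?_⟩
  · obtain ⟨t, rfl⟩ := (κ n).surjective z
    rw [← hincl, hΔ, hΔ, ← hincl, T.seq.der_incl]
  · change κ 0 (E 0 (jetBase δ K z)) = e z
    rw [hE0]
    change κ 0 ((κ 0).symm (e ((AlgEquiv.ofBijective (jetBase δ K)
      (jetBase_bijective δ K)).symm (AlgEquiv.ofBijective (jetBase δ K)
      (jetBase_bijective δ K) z)))) = e z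
    rw [AlgEquiv.symm_apply_apply, AlgEquiv.apply_symm_apply]
  · change κ (n + 1) (E (n + 1) (jetIncl δ K n.le_succ x)) =
      kerIncl δ I P m (n + 1) (κ n (E n x))
    rw [← hincl]
    exact congrArg (κ (n + 1))
      ((congrArg (E (n + 1)) (jetSeq_incl δ K n x)).symm.trans (hE1 n x))
  · exact (congrArg (κ (n + 1)) (hE2 n x)).trans (hΔ n _).symm
  -- This is laterality at the smallest exponent allowed at stage `m + 1` of the tower.
  · have h := congrArg (κ (n + 1)) (T.lateral n n (m + 1) le_rfl le_rfl (by omega) y)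
    rw [hκ' (n + 1) (n + (m + 1 + 1)) h₂] at h
    refine Eq.trans ?_ h
    rw [← hκ' n (n + (m + 1)) h₁ le_rfl, frob, ← hincl, hΔ, PSeq.frob_apply,
      map_add, map_pow, map_mul, piIn, piIn, AlgEquiv.commutes]

end Main

end PiJet

open PiJet in
theorem mainTheorem6 {O : Type*} [CommRing O] [IsDedekindDomain O]
    (π : O) [Fact (Prime π)] [Finite (O ⧸ Ideal.span {π})]
    {R : Type*} [CommRing R] [Algebra O R] (δ : PiDerivation π R)
    {σ : Type*} (I : Ideal (MvPolynomial σ R)) (P : (MvPolynomial σ R ⧸ I) →ₐ[R] R) (m : ℕ)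
    {τ : Type*} (K : Ideal (MvPolynomial τ R))
    (e : (MvPolynomial τ R ⧸ K) ≃ₐ[R] KerAlg δ I P m 1) :
    ∃ (Δ : ∀ n : ℕ, Prolongation δ (kerIncl δ I P m (n + 1)))
      (θ : ∀ n : ℕ, JetAlg δ K n ≃ₐ[R] KerAlg δ I P m (n + 1)),
      (∀ n y, (Δ (n + 1)).toFun (kerIncl δ I P m (n + 1) y) =
        kerIncl δ I P m (n + 2) ((Δ n).toFun y)) ∧
      (∀ a, θ 0 (jetBase δ K a) = e a) ∧
      (∀ n x, θ (n + 1) (jetIncl δ K n.le_succ x) = kerIncl δ I P m (n + 1) (θ n x)) ∧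
      (∀ n x, θ (n + 1) (jetDelta δ K n x) = (Δ n).toFun (θ n x)) ∧
      (∀ (n : ℕ) (y : JetAlg δ I n),
        frob π R (kerIncl δ I P m (n + 1)) (Δ n).toFun
          (kerProj δ I P m (n + 1)
            (jetIncl δ I (by omega : n + (m + 1) ≤ m + (n + 1)) (jetFrobIter δ I n y (m + 1)))) =
        kerProj δ I P m (n + 2)
          (jetIncl δ I (by omega : n + (m + 2) ≤ m + (n + 2))
            (jetFrobIter δ I n y (m + 2)))) :=
  let ⟨Δ, θ, h₁, h₂, h₃, h₄, h₅⟩ := exists_prolongation_kerAlg δ I P m K e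
  ⟨Δ, θ, h₁, h₂, h₃, h₄, fun n y => h₅ n _ _ y⟩
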